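/- Let $p\ge 1$ and let $B$ be a standard $\mathbb{N}^p$-graded algebra over a Noetherian local ring $R=[B]_{\mathbf 0}$ with maximal ideal $\mathfrak m$, i.e. $B$ is generated over $R$ by finitely many elements of the degrees $\mathbf e_1,\ldots,\mathbf e_p$. Let $X=\mathrm{MultiProj}(B)$ be the space of $\mathbb{N}^p$-graded primes of $B$ that do not contain $\bigoplus_{v_1,\ldots,v_p\ge 1}[B]_{\mathbf v}$, and put $r=\dim X$. For $1\le i\le p$ let $H_i\subseteq [B]_{\mathbf e_i}$ be an $R$-submodule with $\mathrm{length}_R([B]_{\mathbf e_i}/H_i)<\infty$, let $I_i=(H_i)\subseteq B$ and $I=I_1+\cdots+I_p$. Fix $\mathbf t\in\mathbb{N}^p$, let $\mathscr H_{\mathbf t}\subseteq B$ be the ideal generated by $[B]_{\mathbf t}$, and let $B_+\subseteq B$ be the ideal of elements of positive total degree. For an ideal $J$ of $B$ put $\mathscr R_J=\bigoplus_{\mathbf n\in\mathbb{N}^p} I_1^{n_1}\cdots I_p^{n_p}J\,T_1^{n_1}\cdots T_p^{n_p}\subseteq B[T_1,\ldots,T_p]$ and $\mathscr R=\mathscr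 R_B$. Let $\mathfrak G=\mathrm{gr}_{I\mathscr R}(\mathscr R)=\bigoplus_{k\ge 0}I^k\mathscr R/I^{k+1}\mathscr R$ (the new joint blow-up algebra) and $\mathfrak G_J=\bigoplus_{k\ge 0}I^k\mathscr R_J/I^{k+1}\mathscr R_J$, a $\mathfrak G$-module. They are bigraded by $\mathbb{N}^p\oplus\mathbb{N}^p$ so that $$[\mathfrak G_J]_{\mathbf v,\mathbf n}=\bigoplus_{k\ge 0}\left[\frac{I^kI_1^{n_1}\cdots I_p^{n_p}J}{I^{k+1}I_1^{n_1}\cdots I_p^{n_p}J}\right]_{\mathbf v+\mathbf n}.$$ For a bigraded $\mathfrak G$-module $N$ such that $\mathrm{length}_R([N]_{\mathbf v,\mathbf n})$ is finite and coincides with a polynomial $P_N(\mathbf v,\mathbf n)$ for all $v_i\gg 0$ and $n_i\gg 0$ (the Hilbert polynomial of $N$), and for $\alpha,\beta\in\mathbb{N}^p$ with $|\alpha|+|\beta|\ge\deg P_N$, the mixed multiplicity $e(\alpha,\beta;N)$ is $\alpha_1!\cdots\alpha_p!\,\beta_1!\cdots\beta_p!$ times the coefficient of $\mathbf v^\alpha\mathbf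 n^\beta$ in $P_N$. Then the function $$\lambda_{\mathbf t}(\mathbf v,\mathbf n)=\mathrm{length}_R\left(\frac{H_1^{n_1}\cdots H_p^{n_p}[B]_{\mathbf v}}{H_1^{v_1+n_1-t_1}\cdots H_p^{v_p+n_p-t_p}[B]_{\mathbf t}}\right)$$ is finite and coincides with a polynomial $P_{\mathbf t}(\mathbf v,\mathbf n)\in\mathbb{Q}[\mathbf v,\mathbf n]$ for all $v_i\gg 0$ and $n_i\gg 0$. This polynomial has total degree at most $r$ (it is zero if $X=\emptyset$), and $$P_{\mathbf t}(\mathbf v,\mathbf n)=\sum_{\substack{\alpha,\beta\in\mathbb{N}^p\\ |\alpha|+|\beta|=r}} e(\alpha,\beta)\,\frac{v_1^{\alpha_1}\cdots v_p^{\alpha_p}\,n_1^{\beta_1}\cdots n_p^{\beta_p}}{\alpha_1!\cdots\alpha_p!\,\beta_1!\cdots\beta_p!}+(\text{terms of lower degree}).$$ Moreover $B_+\mathfrak G_{\mathscr H_{\mathbf t}}$ and its submodule $\mathrm H^0_{\mathfrak m}(B_+\mathfrak G_{\mathscr H_{\mathbf t}})$ of elements killed by a power of $\mathfrak m$ have Hilbert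 polynomials, and for all $\alpha,\beta$ with $|\alpha|+|\beta|=r$ $$e(\alpha,\beta)=j^{\#}_{\alpha,\beta}(H_1,\ldots,H_p;\mathscr H_{\mathbf t}):=e\big(\alpha,\beta;\mathrm H^0_{\mathfrak m}(B_+\mathfrak G_{\mathscr H_{\mathbf t}})\big)=e\big(\alpha,\beta;B_+\mathfrak G_{\mathscr H_{\mathbf t}}\big).$$ -/

import Mathlib

open scoped Polynomial

namespace NewJointBlowUp

noncomputable section

universe u v w

section Setup

variable {p : ℕ} {R : Type u} {B : Type v} [CommRing R] [CommRing B] [Algebra R B]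

/-- An `ℕ^p`-graded `R`-algebra `B` is standard, with `R = [B]_0`: the structure map identifies `R`
with `[B]_0`, and `B` is generated over `R` by finitely many elements, each of which lies in some
`[B]_{e_i}`. -/
structure IsStandardGraded (𝒜 : (Fin p → ℕ) → Submodule R B) : Prop where
  injective_algebraMap : Function.Injective (algebraMap R B)
  degree_zero : 𝒜 0 = 1
  generated : ∃ s : Finset B,
    (∀ b ∈ s, ∃ i : Fin p, b ∈ 𝒜 (Pi.single i 1)) ∧ Algebra.adjoin R (s : Set B) = ⊤

/-- The ideal `B_+` generated by the homogeneous elements of positive total degree. -/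
def idealPlus (𝒜 : (Fin p → ℕ) → Submodule R B) : Ideal B :=
  Ideal.span {b | ∃ d : Fin p → ℕ, 0 < ∑ i, d i ∧ b ∈ 𝒜 d}

/-- The multigraded irrelevant ideal `B_{++}`, generated by the homogeneous elements whose degree
has all its entries positive. -/
def irrelevantIdeal (𝒜 : (Fin p → ℕ) → Submodule R B) : Ideal B :=
  Ideal.span {b | ∃ d : Fin p → ℕ, (∀ i, 1 ≤ d i) ∧ b ∈ 𝒜 d}

/-- The underlying space of `MultiProj(B)`: the `ℕ^p`-graded primes that do not contain `B_{++}`,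
with the topology induced from `Spec B`, whose closed sets are the `V_+(I)`. -/
def MultiProj (𝒜 : (Fin p → ℕ) → Submodule R B) [GradedAlgebra 𝒜] : Set (PrimeSpectrum B) :=
  {x | x.asIdeal.IsHomogeneous 𝒜 ∧ ¬ irrelevantIdeal 𝒜 ≤ x.asIdeal}

/-- The ideal `ℋ_t` of `B` generated by `[B]_t`. -/
def idealOfDegree (𝒜 : (Fin p → ℕ) → Submodule R B) (t : Fin p → ℕ) : Ideal B :=
  Ideal.span (𝒜 t : Set B)

/-- The `R`-module `H_1^{n_1} ⋯ H_p^{n_p} N`, for `R`-submodules `H_i` and `N` of `B`; here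
`H_i^0 = R`. -/
def powMul (H : Fin p → Submodule R B) (n : Fin p → ℕ) (N : Submodule R B) : Submodule R B :=
  (∏ i, H i ^ n i) * N

/-- The function
`λ_t(v, n) = length_R (H_1^{n_1} ⋯ H_p^{n_p} [B]_v / H_1^{v_1+n_1-t_1} ⋯ H_p^{v_p+n_p-t_p} [B]_t)`.
It is meaningful for `v ≥ t`, in which case the denominator is contained in the numerator. -/
def lengthFun (𝒜 : (Fin p → ℕ) → Submodule R B) (H : Fin p → Submodule R B) (t v n : Fin p → ℕ) :
    ℕ∞ :=
  Module.length R
    (↥(powMul H n (𝒜 v)) ⧸ (powMul H (v + n - t) (𝒜 t)).submoduleOf (powMul H n (𝒜 v)))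

end Setup

section Hilbert

variable {p : ℕ}

/-- The function `f(v, n)` coincides with the polynomial `P(v, n)` for all `v_i ≫ 0`, `n_i ≫ 0`
(in particular it is finite there). The variables `v_i` and `n_i` of `P` are indexed by
`Sum.inl i` and `Sum.inr i`. -/
def EventuallyEqPoly (f : (Fin p → ℕ) → (Fin p → ℕ) → ℕ∞) (P : MvPolynomial (Fin p ⊕ Fin p) ℚ) :
    Prop :=
  ∃ N : ℕ, ∀ v n : Fin p → ℕ, (∀ i, N ≤ v i) → (∀ i, N ≤ n i) →
    ∃ l : ℕ, f v n = l ∧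
      MvPolynomial.eval (Sum.elim (fun i => (v i : ℚ)) (fun i => (n i : ℚ))) P = l

/-- The coefficient of `v^α n^β / (α! β!)` in `P(v, n)`. -/
def normalizedCoeff (P : MvPolynomial (Fin p ⊕ Fin p) ℚ) (α β : Fin p → ℕ) : ℚ :=
  ((∏ i, (α i).factorial : ℕ) : ℚ) * ((∏ i, (β i).factorial : ℕ) : ℚ) *
    MvPolynomial.coeff (Finsupp.equivFunOnFinite.symm (Sum.elim α β)) P

variable (R : Type u) [CommRing R] {N : Type v} [AddCommGroup N] [Module R N]

/-- The Hilbert function `(v, n) ↦ length_R [N]_{v,n}` of a bigraded family of `R`-submodules. -/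
def hilbertFun (𝒩 : (Fin p → ℕ) → (Fin p → ℕ) → Submodule R N) (v n : Fin p → ℕ) : ℕ∞ :=
  Module.length R (𝒩 v n)

/-- `P` is the Hilbert polynomial of the bigraded module with graded parts `𝒩 v n`. -/
def IsHilbertPoly (𝒩 : (Fin p → ℕ) → (Fin p → ℕ) → Submodule R N)
    (P : MvPolynomial (Fin p ⊕ Fin p) ℚ) : Prop :=
  EventuallyEqPoly (hilbertFun R 𝒩) P

open Classical in
/-- The mixed multiplicity `e(α, β; N)` of type `(α, β)` of a bigraded module with graded parts
`𝒩 v n`: the normalized coefficient of `v^α n^β` in its (unique) Hilbert polynomial. It is used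
for `|α| + |β|` at least the dimension of the support of the associated sheaf, which is the degree
of that polynomial. The value is `0` by convention if there is no Hilbert polynomial. -/
def mixedMultiplicity (𝒩 : (Fin p → ℕ) → (Fin p → ℕ) → Submodule R N) (α β : Fin p → ℕ) : ℚ :=
  if h : ∃ P, IsHilbertPoly R 𝒩 P then normalizedCoeff h.choose α β else 0

/-- `H^0_𝔪(N)`: the elements of `N` that are killed by a power of the maximal ideal of `R`. -/
def localCohomologyZero [IsLocalRing R] (N : Type v) [AddCommGroup N] [Module R N] :
    Submodule R N :=
  ⨆ k : ℕ, Submodule.torsionBySet R N ((IsLocalRing.maximalIdeal R ^ k : Ideal R) : Set R)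

/-- The graded parts of `H^0_𝔪(N)`, for the bigraded module with graded parts `𝒩 v n`. -/
def localCohomologyZeroParts [IsLocalRing R] (𝒩 : (Fin p → ℕ) → (Fin p → ℕ) → Submodule R N)
    (v n : Fin p → ℕ) : Submodule R N :=
  𝒩 v n ⊓ localCohomologyZero R N

/-- The mixed `j`-multiplicity `j_{α,β}(N) = e(α, β; H^0_𝔪(N))`. -/
def mixedJMultiplicity [IsLocalRing R] (𝒩 : (Fin p → ℕ) → (Fin p → ℕ) → Submodule R N)
    (α β : Fin p → ℕ) : ℚ :=
  mixedMultiplicity R (localCohomologyZeroParts R 𝒩) α β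

end Hilbert

section Rees

variable {B : Type v} [CommRing B]

/-- The multi-Rees algebra `⨁_m (∏ K_i^{m_i}) T^m ⊆ B[T_i : i ∈ σ]` of a finite family of ideals
`K_i` of `B`. -/
def multiRees {σ : Type} [Fintype σ] (K : σ → Ideal B) : Subalgebra B (MvPolynomial σ B) where
  carrier := {f | ∀ m : σ →₀ ℕ, f.coeff m ∈ ∏ i, K i ^ m i}
  mul_mem' := by
    classical
    intro f g hf hg m
    rw [MvPolynomial.coeff_mul]
    refine Ideal.sum_mem _ fun x hx => ?_
    rw [← Finset.HasAntidiagonal.mem_antidiagonal.mp hx]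
    simp only [Finsupp.coe_add, Pi.add_apply, pow_add, Finset.prod_mul_distrib]
    exact Ideal.mul_mem_mul (hf _) (hg _)
  add_mem' := by
    intro f g hf hg m
    rw [MvPolynomial.coeff_add]
    exact add_mem (hf m) (hg m)
  algebraMap_mem' := by
    classical
    intro b m
    rw [MvPolynomial.algebraMap_eq, MvPolynomial.coeff_C]
    split_ifs with h
    · subst h
      simp only [Finsupp.coe_zero, Pi.zero_apply, pow_zero]
      rw [Finset.prod_const_one, Ideal.one_eq_top]
      exact Submodule.mem_top
    · exact zero_mem _

/-- The multi-Rees module `⨁_m (∏ K_i^{m_i}) J T^m ⊆ B[T_i : i ∈ σ]` over the multi-Rees algebra,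
for an ideal `J` of `B` (viewed as a `B`-module). -/
def multiReesModule {σ : Type} [Fintype σ] (K : σ → Ideal B) (J : Ideal B) :
    Submodule (multiRees K) (MvPolynomial σ B) where
  carrier := {f | ∀ m : σ →₀ ℕ, f.coeff m ∈ (∏ i, K i ^ m i) * J}
  add_mem' := by
    intro f g hf hg m
    rw [MvPolynomial.coeff_add]
    exact add_mem (hf m) (hg m)
  zero_mem' := fun m => by
    rw [MvPolynomial.coeff_zero]
    exact zero_mem _
  smul_mem' := by
    classical
    intro c f hf m
    rw [Subalgebra.smul_def, smul_eq_mul, MvPolynomial.coeff_mul]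
    refine Ideal.sum_mem _ fun x hx => ?_
    rw [← Finset.HasAntidiagonal.mem_antidiagonal.mp hx]
    simp only [Finsupp.coe_add, Pi.add_apply, pow_add, Finset.prod_mul_distrib, mul_assoc]
    exact Ideal.mul_mem_mul (c.2 _) (hf _)

variable {p : ℕ}

/-- The ideal `I = I_1 + ⋯ + I_p`. -/
def sumIdeal (I : Fin p → Ideal B) : Ideal B :=
  ∑ i, I i

/-- The family of ideals `I, I_1, …, I_p`, where `I` has the index `none`. -/
def extendedFamily (I : Fin p → Ideal B) (i : Option (Fin p)) : Ideal B :=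
  i.elim (sumIdeal I) I

theorem mem_ideal_smul_iff {σ : Type} (K : Ideal B) (L : (σ →₀ ℕ) → Ideal B)
    (M : Submodule B (MvPolynomial σ B)) (hM : ∀ g, g ∈ M ↔ ∀ m, g.coeff m ∈ L m)
    (g : MvPolynomial σ B) : g ∈ K • M ↔ ∀ m, g.coeff m ∈ K * L m := by
  classical
  constructor
  · intro hg m
    refine Submodule.smul_induction_on hg (fun a ha f hf => ?_) (fun x y hx hy => ?_)
    · rw [MvPolynomial.coeff_smul]
      exact Ideal.mul_mem_mul ha ((hM f).1 hf m)
    · rw [MvPolynomial.coeff_add]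
      exact add_mem hx hy
  · intro h
    rw [g.as_sum]
    refine Submodule.sum_mem _ fun m _ => ?_
    refine Submodule.mul_induction_on (h m) (fun a ha b hb => ?_) (fun x y hx hy => ?_)
    · have hs : MvPolynomial.monomial m (a * b) = a • MvPolynomial.monomial m b := by
        rw [MvPolynomial.smul_monomial, smul_eq_mul]
      rw [hs]
      refine Submodule.smul_mem_smul ha ((hM _).2 fun m' => ?_)
      rw [MvPolynomial.coeff_monomial]
      split_ifs with e
      · exact e ▸ hb
      · exact zero_mem _
    · rw [map_add]
      exact add_mem hx hy

/-- Under `B[T, T_1, …, T_p] = B[T_1, …, T_p][T]`, the algebra `ℭ` consists of the polynomials in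
`T` whose coefficient at `T^k` lies in `I^k ℛ`, for all `k`. -/
theorem mem_jointRees_iff (I : Fin p → Ideal B) (f : MvPolynomial (Option (Fin p)) B) :
    f ∈ multiRees (extendedFamily I) ↔
      ∀ k : ℕ, (MvPolynomial.optionEquivLeft B (Fin p) f).coeff k ∈
        sumIdeal I ^ k • Subalgebra.toSubmodule (multiRees I) := by
  have key : ∀ k : ℕ, (MvPolynomial.optionEquivLeft B (Fin p) f).coeff k ∈
        sumIdeal I ^ k • Subalgebra.toSubmodule (multiRees I) ↔
      ∀ n : Fin p →₀ ℕ, f.coeff (n.optionElim k) ∈ sumIdeal I ^ k * ∏ i, I i ^ n i := fun k => by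
    rw [mem_ideal_smul_iff _ (fun n => ∏ i, I i ^ n i) _ (fun g => Iff.rfl)]
    simp only [MvPolynomial.optionEquivLeft_coeff_coeff]
  simp only [key]
  constructor
  · intro h k n
    simpa [Fintype.prod_option, extendedFamily] using h (n.optionElim k)
  · intro h m
    rw [Fintype.prod_option]
    simpa [extendedFamily] using h (m none) m.some

/-- Under `B[T, T_1, …, T_p] = B[T_1, …, T_p][T]`, the module `ℭ_J` consists of the polynomials in
`T` whose coefficient at `T^k` lies in `I^k ℛ_J`, for all `k`. -/
theorem mem_jointReesModule_iff (I : Fin p → Ideal B) (J : Ideal B)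
    (f : MvPolynomial (Option (Fin p)) B) :
    f ∈ multiReesModule (extendedFamily I) J ↔
      ∀ k : ℕ, (MvPolynomial.optionEquivLeft B (Fin p) f).coeff k ∈
        sumIdeal I ^ k • (multiReesModule I J).restrictScalars B := by
  have key : ∀ k : ℕ, (MvPolynomial.optionEquivLeft B (Fin p) f).coeff k ∈
        sumIdeal I ^ k • (multiReesModule I J).restrictScalars B ↔
      ∀ n : Fin p →₀ ℕ,
        f.coeff (n.optionElim k) ∈ sumIdeal I ^ k * ((∏ i, I i ^ n i) * J) := fun k => by
    rw [mem_ideal_smul_iff _ (fun n => (∏ i, I i ^ n i) * J) _ (fun g => Iff.rfl)]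
    simp only [MvPolynomial.optionEquivLeft_coeff_coeff]
  simp only [key]
  constructor
  · intro h k n
    simpa [Fintype.prod_option, extendedFamily, mul_assoc] using h (n.optionElim k)
  · intro h m
    change f.coeff m ∈ (∏ i, extendedFamily I i ^ m i) * J
    rw [Fintype.prod_option, mul_assoc]
    simpa [extendedFamily] using h (m none) m.some

/-- The Rees algebra `ℭ = ℛ(Iℛ) = ⨁_k I^k ℛ T^k ⊆ ℛ[T]` of the ideal `Iℛ` of the multi-Rees
algebra `ℛ = ⨁_n I_1^{n_1} ⋯ I_p^{n_p} T_1^{n_1} ⋯ T_p^{n_p}`. Inside `B[T, T_1, …, T_p]`, where `T`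
is the variable with index `none`, it is
`⨁_{k,n} I^k I_1^{n_1} ⋯ I_p^{n_p} T^k T_1^{n_1} ⋯ T_p^{n_p}`; see `mem_jointRees_iff`. -/
def JointRees (I : Fin p → Ideal B) : Type v :=
  ↥(multiRees (extendedFamily I))

instance (I : Fin p → Ideal B) : CommRing (JointRees I) :=
  inferInstanceAs (CommRing ↥(multiRees (extendedFamily I)))

instance {R : Type u} [CommRing R] [Algebra R B] (I : Fin p → Ideal B) : Algebra R (JointRees I) :=
  inferInstanceAs (Algebra R ↥(multiRees (extendedFamily I)))

/-- The `ℭ`-module `ℭ_J = ⨁_k I^k ℛ_J T^k ⊆ ℛ_J[T]`, where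
`ℛ_J = ⨁_n I_1^{n_1} ⋯ I_p^{n_p} J T_1^{n_1} ⋯ T_p^{n_p}`; see `mem_jointReesModule_iff`. -/
def JointReesModule (I : Fin p → Ideal B) (J : Ideal B) : Type v :=
  ↥(multiReesModule (extendedFamily I) J)

instance (I : Fin p → Ideal B) (J : Ideal B) : AddCommGroup (JointReesModule I J) :=
  inferInstanceAs (AddCommGroup ↥(multiReesModule (extendedFamily I) J))

instance (I : Fin p → Ideal B) (J : Ideal B) : Module (JointRees I) (JointReesModule I J) :=
  inferInstanceAs
    (Module ↥(multiRees (extendedFamily I)) ↥(multiReesModule (extendedFamily I) J))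

instance {R : Type u} [CommRing R] [Algebra R B] (I : Fin p → Ideal B) (J : Ideal B) :
    Module R (JointReesModule I J) :=
  inferInstanceAs (Module R ↥(multiReesModule (extendedFamily I) J))

instance {R : Type u} [CommRing R] [Algebra R B] (I : Fin p → Ideal B) (J : Ideal B) :
    IsScalarTower R (JointRees I) (JointReesModule I J) :=
  ⟨fun r c x => Subtype.ext (smul_mul_assoc r c.1 x.1)⟩

/-- The ideal `Iℭ` of `ℭ`. -/
def sumIdealJointRees (I : Fin p → Ideal B) : Ideal (JointRees I) :=
  (sumIdeal I).map (algebraMap B (JointRees I))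

/-- The new joint blow-up algebra `𝔊 = ℭ / Iℭ = ⨁_k I^k ℛ / I^{k+1} ℛ`. -/
abbrev JointBlowUp (I : Fin p → Ideal B) : Type v :=
  JointRees I ⧸ sumIdealJointRees I

/-- The `𝔊`-module `𝔊_J = ℭ_J / Iℭ_J = ⨁_k I^k ℛ_J / I^{k+1} ℛ_J`. -/
abbrev JointBlowUpModule (I : Fin p → Ideal B) (J : Ideal B) : Type v :=
  JointReesModule I J ⧸ (sumIdealJointRees I • ⊤ : Submodule (JointRees I) (JointReesModule I J))

/-- The submodule `K𝔊_J` of the `𝔊`-module `𝔊_J`, for an ideal `K` of `B`. -/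
def idealSmulModule (I : Fin p → Ideal B) (J K : Ideal B) :
    Submodule (JointBlowUp I) (JointBlowUpModule I J) :=
  K.map (algebraMap B (JointBlowUp I)) • ⊤

variable {R : Type u} [CommRing R] [Algebra R B]

/-- The part of `ℭ_J` of degree `(v, n)`. Since a homogeneous `b` in `B` has degree `(deg b, 0)`,
while `h T_i` has degree `(0, e_i)` and `h T` has degree `(e_i, 0)` for `h` in `H_i`, this part
consists of the sums of terms `b T^k T_1^{n_1} ⋯ T_p^{n_p}`, for varying `k`, with `b` homogeneous
of degree `v + n`. -/
def jointReesPart (𝒜 : (Fin p → ℕ) → Submodule R B) (I : Fin p → Ideal B) (J : Ideal B)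
    (v n : Fin p → ℕ) : Submodule R (JointReesModule I J) where
  carrier := {f | ∀ m : Option (Fin p) →₀ ℕ, f.1.coeff m ∈ 𝒜 (v + n) ∧
    ((∃ i, m (some i) ≠ n i) → f.1.coeff m = 0)}
  add_mem' := by
    intro f g hf hg m
    refine ⟨?_, fun h => ?_⟩
    · exact add_mem (hf m).1 (hg m).1
    · change f.1.coeff m + g.1.coeff m = 0
      rw [(hf m).2 h, (hg m).2 h, add_zero]
  zero_mem' := fun m => ⟨zero_mem _, fun _ => rfl⟩
  smul_mem' := by
    intro r f hf m
    refine ⟨?_, fun h => ?_⟩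
    · exact Submodule.smul_mem _ r (hf m).1
    · change r • f.1.coeff m = 0
      rw [(hf m).2 h, smul_zero]

/-- The part of `𝔊_J` of degree `(v, n)`: the image of that of `ℭ_J`. -/
def jointBlowUpPart (𝒜 : (Fin p → ℕ) → Submodule R B) (I : Fin p → Ideal B) (J : Ideal B)
    (v n : Fin p → ℕ) : Submodule R (JointBlowUpModule I J) :=
  (jointReesPart 𝒜 I J v n).map
    ((sumIdealJointRees I • ⊤ : Submodule (JointRees I) (JointReesModule I J)).mkQ.restrictScalars R)

/-- The ideals `I_i = (H_i)` of `B`. -/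
def idealsOf (H : Fin p → Submodule R B) (i : Fin p) : Ideal B :=
  Ideal.span (H i : Set B)

/-- The graded parts of the bigraded `𝔊`-module `B_+ 𝔊_{ℋ_t}`, where `𝔊` is the new joint blow-up
algebra of `I_1 = (H_1), …, I_p = (H_p)`. -/
def plusParts (𝒜 : (Fin p → ℕ) → Submodule R B) (H : Fin p → Submodule R B) (t : Fin p → ℕ)
    (v n : Fin p → ℕ) :
    Submodule R (JointBlowUpModule (idealsOf H) (idealOfDegree 𝒜 t)) :=
  (idealSmulModule (idealsOf H) (idealOfDegree 𝒜 t) (idealPlus 𝒜)).restrictScalars R ⊓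
    jointBlowUpPart 𝒜 (idealsOf H) (idealOfDegree 𝒜 t) v n

end Rees

end

end NewJointBlowUp

/-! The polynomial of `λ_t` is the Hilbert polynomial of `B_+ 𝔊_{ℋ_t}` itself, because the two
functions agree as soon as `v ≥ t`.

Filter by the parts of degree `v + n` of the ideals `I^k I_1^{n_1} ⋯ I_p^{n_p} ℋ_t`, called
`blowUpPart`. For `k = 0` this part is the numerator of `λ_t`, for `k = |v| - |t|` it is the
denominator (`blowUpPart_zero`, `blowUpPart_last`), so `λ_t(v, n)` is the sum of the lengths of the
successive quotients for `k < |v| - |t|`. These are exactly the pieces that multiplication by `B_+`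
leaves in `[𝔊_{ℋ_t}]_{v,n}`. The `k`-th ideal is generated in total degree `k + |n| + |t|`: its
elements of larger degree lie in `B_+` times it, while `B_+` times it is zero in degrees at most
that (`blowUpPart_le_idealPlus_mul`, `eq_zero_of_mem_idealPlus_mul`). Hence `length_plusParts`.

Existence of a polynomial is Hilbert's theorem for `ℕ^{2p}`-graded modules. The module is Noetherian
by the basis theorem (`isNoetherianFamily_of_generated`), and an induction on the variables that act
nontrivially reduces to kernels and cokernels (`exists_hilbertPolynomial_of_active`). Everything is
done with families of submodules of a fixed ring instead of graded modules.

For the degree, some `𝔪^c` multiplies every `[B]_{e_i}` into `H_i`, so `λ_t(v, n)` is at most the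
length of `[B]_w / 𝔪^s [B]_w` with `w = v + n` and `s` linear in `w` (`lengthFun_le`). A dévissage
over homogeneous ideals bounds this by a multiple of `(|w| + s + 1)^r` when `MultiProj` has finite
dimension `r` (`hasGrowth_of_coheight_lt`), and a polynomial of such growth has degree at most `r`.

Finally, a part of finite length is killed by a power of `𝔪`. So `H^0_𝔪` changes nothing in the
degrees that matter, and one polynomial serves all three functions. -/

namespace NewJointBlowUp

/-! ### Lengths of quotients of submodules -/

section RelLength

variable {R M N : Type*} [CommRing R] [AddCommGroup M] [Module R M] [AddCommGroup N] [Module R N]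

theorem mapQ_injective {U : Submodule R M} {V : Submodule R N} (f : M →ₗ[R] N) (h : U ≤ V.comap f)
    (h' : V.comap f ≤ U) : Function.Injective (U.mapQ V f h) := by
  rw [← LinearMap.ker_eq_bot, Submodule.ker_mapQ, eq_bot_iff, Submodule.map_le_iff_le_comap]
  intro x hx
  exact (Submodule.Quotient.mk_eq_zero _).2 (h' hx)

/-- The length of `U / (U ∩ V)`. -/
noncomputable def relLength (U V : Submodule R M) : ℕ∞ :=
  Module.length R (↥U ⧸ V.submoduleOf U)

/-- The hypotheses say that `f` induces a surjection from `U / (U ∩ V)` onto `U' / (U' ∩ V')`. They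
constrain `f` only on `U`, and surjectivity only modulo `V'`, so that lengths can be transported
along maps of large ambient modules. -/
theorem relLength_le_of_map (f : M →ₗ[R] N) {U V : Submodule R M} {U' V' : Submodule R N}
    (hU : ∀ u ∈ U, f u ∈ U') (hV : ∀ u ∈ U, u ∈ V → f u ∈ V')
    (hs : ∀ y ∈ U', ∃ u ∈ U, y - f u ∈ V') : relLength U' V' ≤ relLength U V := by
  let g : ↥U →ₗ[R] ↥U' := f.restrict hU
  have hg : V.submoduleOf U ≤ (V'.submoduleOf U').comap g := fun u hu => hV u.1 u.2 hu
  refine Module.length_le_of_surjective ((V.submoduleOf U).mapQ (V'.submoduleOf U') g hg) ?_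
  intro y
  obtain ⟨y, rfl⟩ := Submodule.Quotient.mk_surjective _ y
  obtain ⟨u, hu, h⟩ := hs y.1 y.2
  refine ⟨Submodule.Quotient.mk ⟨u, hu⟩, ?_⟩
  rw [Submodule.mapQ_apply, eq_comm, Submodule.Quotient.eq]
  exact h

theorem relLength_eq_of_map (f : M →ₗ[R] N) {U V : Submodule R M} {U' V' : Submodule R N}
    (hU : ∀ u ∈ U, f u ∈ U') (hV : ∀ u ∈ U, f u ∈ V' ↔ u ∈ V)
    (hs : ∀ y ∈ U', ∃ u ∈ U, y - f u ∈ V') : relLength U' V' = relLength U V := by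
  refine le_antisymm (relLength_le_of_map f hU (fun u hu => (hV u hu).2) hs) ?_
  let g : ↥U →ₗ[R] ↥U' := f.restrict hU
  have hg : V.submoduleOf U ≤ (V'.submoduleOf U').comap g := fun u hu => (hV u.1 u.2).2 hu
  refine Module.length_le_of_injective ((V.submoduleOf U).mapQ (V'.submoduleOf U') g hg)
    (mapQ_injective _ _ fun u hu => (hV u.1 u.2).1 hu)

theorem relLength_add {U V W : Submodule R M} (h₁ : W ≤ V) (h₂ : V ≤ U) :
    relLength U W = relLength U V + relLength V W := by
  let a : (↥V ⧸ W.submoduleOf V) →ₗ[R] (↥U ⧸ W.submoduleOf U) :=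
    (W.submoduleOf V).mapQ (W.submoduleOf U) (Submodule.inclusion h₂) (fun _ h => h)
  let b : (↥U ⧸ W.submoduleOf U) →ₗ[R] (↥U ⧸ V.submoduleOf U) :=
    (W.submoduleOf U).mapQ (V.submoduleOf U) LinearMap.id (fun _ h => h₁ h)
  have ha : Function.Injective a := mapQ_injective _ _ (fun _ h => h)
  have hb : Function.Surjective b := by
    intro y
    obtain ⟨y, rfl⟩ := Submodule.Quotient.mk_surjective _ y
    exact ⟨Submodule.Quotient.mk y, rfl⟩
  have hab : Function.Exact a b := by
    intro y
    obtain ⟨y, rfl⟩ := Submodule.Quotient.mk_surjective _ y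
    constructor
    · intro h
      have h' : y ∈ V.submoduleOf U := (Submodule.Quotient.mk_eq_zero _).1 h
      exact ⟨Submodule.Quotient.mk ⟨y.1, h'⟩, rfl⟩
    · rintro ⟨z, hz⟩
      obtain ⟨z, rfl⟩ := Submodule.Quotient.mk_surjective _ z
      rw [← hz]
      exact (Submodule.Quotient.mk_eq_zero _).2 z.2
  rw [relLength, Module.length_eq_add_of_exact a b ha hb hab, add_comm]
  rfl

theorem relLength_eq_zero_iff {U V : Submodule R M} : relLength U V = 0 ↔ U ≤ V := by
  rw [relLength, Module.length_eq_zero_iff, Submodule.Quotient.subsingleton_iff,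
    Submodule.submoduleOf_eq_top]

theorem relLength_anti_right (U : Submodule R M) {V V' : Submodule R M} (h : V ≤ V') :
    relLength U V' ≤ relLength U V :=
  relLength_le_of_map LinearMap.id (fun _ h => h) (fun _ _ h' => h h')
    (fun y hy => ⟨y, hy, by simp⟩)

theorem relLength_mono_left {U U' : Submodule R M} (V : Submodule R M) (h : U ≤ U') :
    relLength U V ≤ relLength U' V :=
  Module.length_le_of_injective
    ((V.submoduleOf U).mapQ (V.submoduleOf U') (Submodule.inclusion h) (fun _ h => h))
    (mapQ_injective _ _ (fun _ h => h))

theorem relLength_bot (U : Submodule R M) : relLength U ⊥ = Module.length R U := by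
  have : (⊥ : Submodule R M).submoduleOf U = ⊥ := by
    ext x; simp [Submodule.submoduleOf]
  rw [relLength, this]
  exact (Submodule.quotEquivOfEqBot ⊥ rfl).length_eq

theorem relLength_sum {F : ℕ → Submodule R M} (hF : Antitone F) (K : ℕ) :
    relLength (F 0) (F K) = ∑ k ∈ Finset.range K, relLength (F k) (F (k + 1)) := by
  induction K with
  | zero => simp [relLength_eq_zero_iff]
  | succ K ih =>
    rw [relLength_add (hF (Nat.le_succ K)) (hF (Nat.zero_le K)), ih, Finset.sum_range_succ]

/-- Submodules `V ⊆ U` of the source of `f` and the quotient of the target by `f`: the difference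
formula for the kernel and cokernel of the map `U / V → U' / V'` induced by `f`. -/
theorem relLength_ker_coker (f : M →ₗ[R] N) {U V : Submodule R M} {U' V' : Submodule R N}
    (hV : V ≤ U) (hV' : V' ≤ U') (hU : U ≤ U'.comap f) (hf : V ≤ V'.comap f) :
    relLength U' V' + relLength (U ⊓ V'.comap f) V =
      relLength U' (V' ⊔ U.map f) + relLength U V := by
  rw [relLength_add (le_sup_left : V' ≤ V' ⊔ U.map f) (sup_le hV' (Submodule.map_le_iff_le_comap.2 hU)),
    relLength_add (le_inf hV hf) (inf_le_left : U ⊓ V'.comap f ≤ U), add_assoc]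
  congr 2
  refine relLength_eq_of_map f (fun u hu => ?_) (fun u hu => ?_) (fun y hy => ?_)
  · exact Submodule.mem_sup_right (Submodule.mem_map_of_mem hu)
  · simp [hu]
  · obtain ⟨a, ha, b, hb, rfl⟩ := Submodule.mem_sup.1 hy
    obtain ⟨u, hu, rfl⟩ := hb
    exact ⟨u, hu, by simpa using ha⟩

end RelLength

/-! ### Functions that are eventually polynomial: antidifferences and degree bounds -/

section EventuallyPolynomial

variable {σ : Type*}

/-- `f` coincides with the polynomial `P` at all points with large coordinates. -/
def AgreesEventually (f : (σ → ℕ) → ℚ) (P : MvPolynomial σ ℚ) : Prop :=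
  ∃ N : ℕ, ∀ v : σ → ℕ, (∀ i, N ≤ v i) → f v = MvPolynomial.eval (fun i => (v i : ℚ)) P

theorem eval_nat_eq_imp_eq {P Q : MvPolynomial σ ℚ} (N : ℕ)
    (h : ∀ v : σ → ℕ, (∀ i, N ≤ v i) → MvPolynomial.eval (fun i => (v i : ℚ)) P =
      MvPolynomial.eval (fun i => (v i : ℚ)) Q) : P = Q := by
  refine MvPolynomial.funext_set (fun _ => (Nat.cast : ℕ → ℚ) '' Set.Ici N) (fun _ =>
    (Set.Ici_infinite N).image Nat.cast_injective.injOn) fun x hx => ?_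
  choose v hv hvx using fun i => hx i (Set.mem_univ i)
  obtain rfl : (fun i => (v i : ℚ)) = x := funext hvx
  exact h v hv

variable [Fintype σ]


/-- Bernoulli polynomials satisfy `B_{k+1}(x + 1) - B_{k+1}(x) = (k + 1) x^k`. In a monomial, the
power `X_i^k` is replaced by `B_{k+1}(X_i) / (k + 1)`; the other factors do not see the shift. -/
theorem exists_antidifference [DecidableEq σ] (i : σ) (Q : MvPolynomial σ ℚ) :
    ∃ S : MvPolynomial σ ℚ, ∀ x : σ → ℚ, MvPolynomial.eval (x + Pi.single i 1) S =
      MvPolynomial.eval x S + MvPolynomial.eval x Q := by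
  induction Q using MvPolynomial.induction_on' with
  | monomial u a =>
    let k := u i
    let q : MvPolynomial σ ℚ :=
      MvPolynomial.C (a / (k + 1)) * ∏ j ∈ Finset.univ.erase i, MvPolynomial.X j ^ u j
    refine ⟨q * Polynomial.aeval (MvPolynomial.X i) (Polynomial.bernoulli (k + 1)), fun x => ?_⟩
    have h1 : ∀ y : σ → ℚ, MvPolynomial.eval y (Polynomial.aeval (MvPolynomial.X i)
        (Polynomial.bernoulli (k + 1))) = (Polynomial.bernoulli (k + 1)).eval (y i) := by
      intro y
      rw [← MvPolynomial.coe_aeval_eq_eval, RingHom.coe_coe, ← Polynomial.aeval_algHom_apply]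
      simp
    have h2 : MvPolynomial.eval (x + Pi.single i 1) q = MvPolynomial.eval x q := by
      simp only [q, map_mul, map_prod, MvPolynomial.eval_C, map_pow, MvPolynomial.eval_X]
      congr 1
      refine Finset.prod_congr rfl fun j hj => ?_
      rw [Pi.add_apply, Pi.single_eq_of_ne (Finset.ne_of_mem_erase hj), add_zero]
    have h3 : MvPolynomial.eval x (MvPolynomial.monomial u a) =
        MvPolynomial.eval x q * ((k + 1) * x i ^ k) := by
      rw [MvPolynomial.eval_monomial, Finsupp.prod_fintype _ _ (by simp)]
      simp only [q, map_mul, map_prod, MvPolynomial.eval_C, map_pow, MvPolynomial.eval_X]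
      rw [← Finset.mul_prod_erase Finset.univ _ (Finset.mem_univ i)]
      have : (k + 1 : ℚ) ≠ 0 := by positivity
      simp only [k]
      field_simp
    rw [map_mul (MvPolynomial.eval _) q, map_mul (MvPolynomial.eval _) q, h1, h1, h2, h3, Pi.add_apply, Pi.single_eq_same, add_comm (x i) 1,
      Polynomial.bernoulli_eval_one_add]
    push_cast
    ring
  | add P Q hP hQ =>
    obtain ⟨S, hS⟩ := hP
    obtain ⟨T, hT⟩ := hQ
    refine ⟨S + T, fun x => ?_⟩
    simp only [map_add, hS, hT]
    ring


/-- The coordinates are freed one at a time, all others being frozen at a common threshold `N₀`.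
Freeing the coordinate `i` adds the sum of the `i`-th differences from `N₀` to `v i`, which is
polynomial by `exists_antidifference`. -/
theorem exists_agreesEventually_of_differences [DecidableEq σ] (f : (σ → ℕ) → ℚ)
    (h : ∀ i, ∃ Q, AgreesEventually (fun v => f (v + Pi.single i 1) - f v) Q) :
    ∃ P, AgreesEventually f P := by
  choose Q N hN using h
  let N₀ := Finset.univ.sup N
  have hN₀ : ∀ i, N i ≤ N₀ := fun i => Finset.le_sup (Finset.mem_univ i)
  suffices H : ∀ s : Finset σ, ∃ P : MvPolynomial σ ℚ, ∀ v : σ → ℕ, (∀ i, N₀ ≤ v i) →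
      f (fun j => if j ∈ s then v j else N₀) = MvPolynomial.eval (fun i => (v i : ℚ)) P by
    obtain ⟨P, hP⟩ := H Finset.univ
    exact ⟨P, N₀, fun v hv => by simpa using hP v hv⟩
  intro s
  induction s using Finset.induction_on with
  | empty => exact ⟨MvPolynomial.C (f fun _ => N₀), fun v _ => by simp⟩
  | insert i s hi ih =>
    obtain ⟨P, hP⟩ := ih
    -- The polynomial of the `i`-th difference, with the coordinates outside `insert i s` set to
    -- `N₀`.
    let Q' : MvPolynomial σ ℚ := MvPolynomial.aeval
      (fun j => if j ∈ insert i s then MvPolynomial.X j else MvPolynomial.C (N₀ : ℚ)) (Q i)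
    obtain ⟨S, hS⟩ := exists_antidifference i Q'
    -- `S₀` is `S` at `x_i = N₀`, so `S - S₀` is the sum of the differences from `N₀` up to `x_i`.
    let S₀ : MvPolynomial σ ℚ := MvPolynomial.aeval
      (fun j => if j = i then MvPolynomial.C (N₀ : ℚ) else MvPolynomial.X j) S
    have hS₀ : ∀ x : σ → ℚ, MvPolynomial.eval x S₀ =
        MvPolynomial.eval (Function.update x i N₀) S := by
      intro x
      simp only [S₀, ← MvPolynomial.coe_aeval_eq_eval, RingHom.coe_coe]
      rw [← AlgHom.comp_apply, MvPolynomial.comp_aeval]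
      congr 2
      ext j
      by_cases hj : j = i
      · subst hj; simp
      · simp [hj]
    have hQ' : ∀ x : σ → ℚ, MvPolynomial.eval x Q' =
        MvPolynomial.eval (fun j => if j ∈ insert i s then x j else N₀) (Q i) := by
      intro x
      simp only [Q', ← MvPolynomial.coe_aeval_eq_eval, RingHom.coe_coe]
      rw [← AlgHom.comp_apply, MvPolynomial.comp_aeval]
      congr 2
      ext j
      split_ifs <;> simp
    refine ⟨P + S - S₀, fun v hv => ?_⟩
    have key : ∀ n : ℕ, ∀ w : σ → ℕ, (∀ i, N₀ ≤ w i) → w i = N₀ + n →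
        f (fun j => if j ∈ insert i s then w j else N₀) =
          MvPolynomial.eval (fun i => (w i : ℚ)) (P + S - S₀) := by
      intro n
      induction n with
      | zero =>
        intro w hw hwi
        have e1 : (fun j => if j ∈ insert i s then w j else N₀) =
            fun j => if j ∈ s then w j else N₀ := by
          ext j
          by_cases hj : j = i
          · subst hj; simp [hi, hwi]
          · simp [hj]
        have e2 : Function.update (fun i => (w i : ℚ)) i N₀ = fun i => (w i : ℚ) := by
          ext j
          by_cases hj : j = i
          · subst hj; simp [hwi]
          · simp [hj]
        rw [e1, hP w hw, map_sub, map_add, hS₀, e2]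
        ring
      | succ n ihn =>
        intro w hw hwi
        let w' := Function.update w i (N₀ + n)
        have hw'i : w' i = N₀ + n := by simp [w']
        have hw'j : ∀ j, j ≠ i → w' j = w j := fun j hj => by simp [w', hj]
        have hw' : ∀ j, N₀ ≤ w' j := by
          intro j
          by_cases hj : j = i
          · subst hj; omega
          · rw [hw'j j hj]; exact hw j
        have e1 : (fun j => if j ∈ insert i s then w j else N₀) =
            (fun j => if j ∈ insert i s then w' j else N₀) + Pi.single i 1 := by
          ext j
          by_cases hj : j = i
          · subst hj; simp [hw'i, hwi]; omega
          · simp [hj, hw'j]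
        have e2 : (fun j => (w j : ℚ)) = (fun j => (w' j : ℚ)) + Pi.single i 1 := by
          ext j
          by_cases hj : j = i
          · subst hj; simp [hw'i, hwi]; ring
          · simp [hj, hw'j]
        have e3 : (fun j => if j ∈ s then w j else N₀) = fun j => if j ∈ s then w' j else N₀ := by
          ext j
          split_ifs with hj
          · exact (hw'j j (fun h => hi (h ▸ hj))).symm
          · rfl
        have e4 : Function.update (fun i => (w i : ℚ)) i N₀ =
            Function.update (fun i => (w' i : ℚ)) i N₀ := by
          ext j
          by_cases hj : j = i
          · subst hj; simp
          · simp [hj, hw'j]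
        have a1 := hN i (fun j => if j ∈ insert i s then w' j else N₀) (fun j => by
          split_ifs
          · exact (hN₀ i).trans (hw' j)
          · exact hN₀ i)
        have a2 := ihn w' hw' hw'i
        have a3 := hP w hw
        have a4 := hP w' hw'
        have a5 : (fun j => (((if j ∈ insert i s then w' j else N₀ : ℕ) : ℕ) : ℚ)) =
            fun j => if j ∈ insert i s then (w' j : ℚ) else N₀ := by
          ext j; split_ifs <;> rfl
        simp only at a1
        rw [← e1, a2, a5, ← hQ'] at a1
        rw [e3, a4] at a3
        rw [map_sub, map_add, ← a3, hS₀, e4, ← hS₀, e2, hS]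
        rw [map_sub, map_add] at a1
        linarith
    exact key (v i - N₀) v hv (by have := hv i; omega)

theorem natDegree_le_of_eval_le (q : Polynomial ℚ) (N r : ℕ) (C : ℚ)
    (h : ∀ s : ℕ, N ≤ s → |q.eval (s : ℚ)| ≤ C * (s : ℚ) ^ r) : q.natDegree ≤ r := by
  by_contra! hlt
  have h0 : (Polynomial.X ^ r : Polynomial ℚ).degree < q.degree := by
    rw [Polynomial.degree_X_pow]
    exact Polynomial.coe_lt_degree.2 hlt
  have h1 := Polynomial.abs_div_tendsto_atTop_atTop_of_degree_gt q (Polynomial.X ^ r) h0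
    (pow_ne_zero _ Polynomial.X_ne_zero)
  have h2 := (h1.comp (tendsto_natCast_atTop_atTop (R := ℚ))).eventually_gt_atTop C
  obtain ⟨s, hs1, hs2, hs3⟩ := (h2.and ((Filter.eventually_ge_atTop N).and
    (Filter.eventually_gt_atTop 0))).exists
  have h3 : (0 : ℚ) < (s : ℚ) ^ r := by positivity
  simp only [Function.comp_apply, Polynomial.eval_pow, Polynomial.eval_X] at hs1
  rw [abs_div, abs_of_pos h3, lt_div_iff₀ h3] at hs1
  exact absurd (h s hs2) (not_le.2 hs1)

theorem eval_smul_of_isHomogeneous {φ : MvPolynomial σ ℚ} {n : ℕ} (hφ : φ.IsHomogeneous n) (s : ℚ)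
    (a : σ → ℚ) : MvPolynomial.eval (fun i => s * a i) φ = s ^ n * MvPolynomial.eval a φ := by
  rw [MvPolynomial.eval_eq', MvPolynomial.eval_eq', Finset.mul_sum]
  refine Finset.sum_congr rfl fun d hd => ?_
  have h : ∑ i, d i = n := by
    rw [← hφ (MvPolynomial.mem_support_iff.1 hd), ← Finsupp.degree_eq_sum]
    exact DFunLike.congr_fun Finsupp.degree_eq_weight_one d
  simp_rw [mul_pow]
  rw [Finset.prod_mul_distrib, Finset.prod_pow_eq_pow_sum, h]
  ring

/-- On a ray `s ↦ s · a` on which the top homogeneous component does not vanish, `P` becomes a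
polynomial in `s` of the same degree, and the one-variable bound applies. -/
theorem totalDegree_le_of_eval_le (P : MvPolynomial σ ℚ) (N r : ℕ) (C : ℚ)
    (h : ∀ v : σ → ℕ, (∀ i, N ≤ v i) →
      |MvPolynomial.eval (fun i => (v i : ℚ)) P| ≤ C * (∑ i, (v i : ℚ)) ^ r) :
    P.totalDegree ≤ r := by
  by_contra! hlt
  set D := P.totalDegree with hD
  have hP : P ≠ 0 := by rintro rfl; simp at hD; omega
  have htop : MvPolynomial.homogeneousComponent D P ≠ 0 := by
    obtain ⟨d, hd, hdD⟩ := Finset.exists_mem_eq_sup P.support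
      (MvPolynomial.support_nonempty.2 hP) (fun s => s.sum fun _ e => e)
    intro h0
    have h1 := congrArg (MvPolynomial.coeff d) h0
    rw [MvPolynomial.coeff_homogeneousComponent, if_pos, MvPolynomial.coeff_zero] at h1
    · exact MvPolynomial.mem_support_iff.1 hd h1
    · exact hdD.symm
  -- Positive entries of `a` guarantee that `s · a` passes the threshold `N` once `s ≥ N`.
  obtain ⟨a, ha, hne⟩ : ∃ a : σ → ℕ, (∀ i, 1 ≤ a i) ∧
      MvPolynomial.eval (fun i => (a i : ℚ)) (MvPolynomial.homogeneousComponent D P) ≠ 0 := by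
    by_contra! hall
    exact htop (eval_nat_eq_imp_eq 1 fun v hv => by rw [hall v hv, map_zero])
  let c : ℕ → ℚ := fun k =>
    MvPolynomial.eval (fun i => (a i : ℚ)) (MvPolynomial.homogeneousComponent k P)
  let q : Polynomial ℚ := ∑ k ∈ Finset.range (D + 1), Polynomial.monomial k (c k)
  have hq : ∀ s : ℚ, q.eval s = MvPolynomial.eval (fun i => s * (a i : ℚ)) P := by
    intro s
    conv_rhs => rw [← MvPolynomial.sum_homogeneousComponent P]
    rw [Polynomial.eval_finsetSum, map_sum]
    refine Finset.sum_congr rfl fun k _ => ?_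
    rw [Polynomial.eval_monomial]
    rw [eval_smul_of_isHomogeneous (MvPolynomial.homogeneousComponent_isHomogeneous k P), mul_comm]
  have hcoeff : q.coeff D = c D := by
    simp [q, Polynomial.finsetSum_coeff, Polynomial.coeff_monomial]
  have hdeg : D ≤ q.natDegree := Polynomial.le_natDegree_of_ne_zero (hcoeff ▸ hne)
  have := natDegree_le_of_eval_le q N r (C * (∑ i, (a i : ℚ)) ^ r) fun s hs => by
    have := h (fun i => s * a i) (fun i => hs.trans (Nat.le_mul_of_pos_right s (ha i)))
    rw [hq]
    simp only [Nat.cast_mul] at this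
    rw [← Finset.mul_sum, mul_pow] at this
    linarith
  omega

end EventuallyPolynomial

/-! ### Hilbert polynomials of multigraded families of submodules -/

section Families

variable {R A σ κ : Type*} [CommRing R] [CommRing A] [Algebra R A] [DecidableEq σ]

/-- The family `W` of submodules of `A`, indexed by `ℕ^σ`, is closed under the multiplication by
the elements `a k`, which are considered as homogeneous elements of degree `e_{c k}`. -/
def IsStable (c : κ → σ) (a : κ → A) (W : (σ → ℕ) → Submodule R A) : Prop :=
  ∀ k v, ∀ x ∈ W v, a k * x ∈ W (v + Pi.single (c k) 1)

/-- Ascending chains of stable families below `U` become stationary. -/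
def IsNoetherianFamily (c : κ → σ) (a : κ → A) (U : (σ → ℕ) → Submodule R A) : Prop :=
  ∀ W : ℕ → (σ → ℕ) → Submodule R A, Monotone W → (∀ k, IsStable c a (W k)) → (∀ k, W k ≤ U) →
    ∃ k₀, ∀ k, k₀ ≤ k → W k₀ = W k

theorem IsNoetherianFamily.mono {c : κ → σ} {a : κ → A} {U U' : (σ → ℕ) → Submodule R A}
    (h : IsNoetherianFamily c a U) (hU : U' ≤ U) : IsNoetherianFamily c a U' :=
  fun W hW hs hle => h W hW hs fun k => (hle k).trans hU

/-- Stable families become submodules of `A[T_σ]` over the subalgebra `S` generated by the `a_k T_{c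
k}`, by collecting coefficients. `S` is a finitely generated `R`-algebra, hence Noetherian, and `U`
embeds in the finitely generated module `N` spanned by the `g i`. The `g i` themselves need not
belong to `U`. -/
theorem isNoetherianFamily_of_generated [Finite κ] [IsNoetherianRing R] [Finite σ] (c : κ → σ)
    (a : κ → A) (U : (σ → ℕ) → Submodule R A) {γ : Type*} [Finite γ] (d : γ → σ → ℕ) (g : γ → A)
    (hg : ∀ W : (σ → ℕ) → Submodule R A, IsStable c a W → (∀ i, g i ∈ W (d i)) → U ≤ W) :
    IsNoetherianFamily c a U := by
  classical
  let μ : (σ → ℕ) → A → MvPolynomial σ A := fun v => MvPolynomial.monomial (Finsupp.equivFunOnFinite.symm v)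
  let S : Subalgebra R (MvPolynomial σ A) :=
    Algebra.adjoin R (Set.range fun k => μ (Pi.single (c k) 1) (a k))
  have hSfg : S.FG := Subalgebra.fg_def.2 ⟨_, Set.finite_range _, rfl⟩
  have : IsNoetherianRing S := isNoetherianRing_of_fg hSfg
  let toSub (W : (σ → ℕ) → Submodule R A) (hW : IsStable c a W) :
      Submodule S (MvPolynomial σ A) :=
    { carrier := {f | ∀ v : σ →₀ ℕ, f.coeff v ∈ W v}
      add_mem' := fun hf hg v => by
        rw [MvPolynomial.coeff_add]; exact add_mem (hf v) (hg v)
      zero_mem' := fun v => by rw [MvPolynomial.coeff_zero]; exact zero_mem _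
      smul_mem' := by
        rintro ⟨s, hs⟩ f hf
        change ∀ v : σ →₀ ℕ, (s * f).coeff v ∈ W v
        induction hs using Algebra.adjoin_induction generalizing f with
        | mem x hx =>
          obtain ⟨k, rfl⟩ := hx
          intro v
          simp only [μ, MvPolynomial.coeff_monomial_mul']
          split_ifs with h
          · have := hW k _ _ (hf (v - Finsupp.equivFunOnFinite.symm (Pi.single (c k) 1)))
            convert this using 1
            congr 1
            ext j
            exact (Nat.sub_add_cancel (h j)).symm
          · exact zero_mem _
        | algebraMap r =>
          intro v
          rw [← Algebra.smul_def, MvPolynomial.coeff_smul]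
          exact Submodule.smul_mem _ _ (hf v)
        | add x y _ _ hx hy =>
          intro v
          rw [add_mul, MvPolynomial.coeff_add]
          exact add_mem (hx hf v) (hy hf v)
        | mul x y _ _ hx hy =>
          rw [mul_assoc]
          exact hx (hy hf) }
  have hμ : ∀ (W) (hW : IsStable c a W) (v x), μ v x ∈ toSub W hW ↔ x ∈ W v := by
    intro W hW v x
    constructor
    · intro h
      have := h (Finsupp.equivFunOnFinite.symm v)
      simpa [μ] using this
    · intro h u
      simp only [μ, MvPolynomial.coeff_monomial]
      split_ifs with hu
      · subst hu; exact h
      · exact zero_mem _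
  let N : Submodule S (MvPolynomial σ A) := Submodule.span S (Set.range fun i => μ (d i) (g i))
  have hN : IsNoetherian S N := isNoetherian_span_of_finite S (Set.finite_range _)
  -- The graded parts of `N` form a stable family containing the generators, so `hg` puts `U` inside
  -- it.
  let W₀ : (σ → ℕ) → Submodule R A := fun v =>
    (N.restrictScalars R).comap 
      ((MvPolynomial.monomial (R := A) (Finsupp.equivFunOnFinite.symm v)).restrictScalars R)
  have hU : ∀ v, ∀ x ∈ U v, μ v x ∈ N := by
    intro v x hx
    refine hg W₀ ?_ ?_ v hx
    · intro k v x hx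
      have h1 : μ (Pi.single (c k) 1) (a k) ∈ S := Algebra.subset_adjoin ⟨k, rfl⟩
      have h2 := N.smul_mem ⟨_, h1⟩ hx
      have h3 : μ (Pi.single (c k) 1) (a k) * μ v x = μ (v + Pi.single (c k) 1) (a k * x) := by
        simp only [μ, MvPolynomial.monomial_mul]
        congr 2
        ext j
        exact add_comm _ _
      change μ (v + Pi.single (c k) 1) (a k * x) ∈ N
      rw [← h3]
      exact h2
    · exact fun i => Submodule.subset_span ⟨i, rfl⟩
  have hle : ∀ (W) (hW : IsStable c a W), W ≤ U → toSub W hW ≤ N := by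
    intro W hW hWU f hf
    rw [f.as_sum]
    exact Submodule.sum_mem _ fun v _ => by
      simpa [μ] using hU v _ (hWU _ (hf v))
  intro W hmono hW hWU
  let chain : ℕ →o Submodule S N :=
    { toFun := fun k => (toSub (W k) (hW k)).submoduleOf N
      monotone' := fun i j hij x hx v => hmono hij v (hx v) }
  obtain ⟨k₀, hk₀⟩ := monotone_stabilizes_iff_noetherian.2 hN chain
  refine ⟨k₀, fun k hk => le_antisymm (hmono hk) fun v x hx => ?_⟩
  have hx' : μ v x ∈ N := hU v x (hWU k v hx)
  have : (⟨μ v x, hx'⟩ : N) ∈ chain k := (hμ _ (hW k) v x).2 hx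
  rw [← hk₀ k hk] at this
  exact (hμ _ (hW k₀) v x).1 this

variable {c : κ → σ} {a : κ → A} {U V : (σ → ℕ) → Submodule R A}

/-- The family of the kernels of the multiplication by `a k` on `U / V`. -/
def kerFamily (c : κ → σ) (a : κ → A) (U V : (σ → ℕ) → Submodule R A) (k : κ) (v : σ → ℕ) :
    Submodule R A :=
  U v ⊓ (V (v + Pi.single (c k) 1)).comap (LinearMap.mulLeft R (a k))

/-- The family `V + a_k U`. -/
def cokerFamily (c : κ → σ) (a : κ → A) (U V : (σ → ℕ) → Submodule R A) (k : κ) (v : σ → ℕ) :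
    Submodule R A :=
  V v ⊔ ⨆ (w) (_ : w + Pi.single (c k) 1 = v), (U w).map (LinearMap.mulLeft R (a k))

theorem cokerFamily_add (k : κ) (v : σ → ℕ) : cokerFamily c a U V k (v + Pi.single (c k) 1) =
    V (v + Pi.single (c k) 1) ⊔ (U v).map (LinearMap.mulLeft R (a k)) := by
  unfold cokerFamily
  congr 1
  refine le_antisymm (iSup₂_le fun w hw => ?_) (le_iSup₂_of_le v rfl le_rfl)
  rw [add_right_cancel hw]

theorem isStable_kerFamily (hU : IsStable c a U) (hV : IsStable c a V) (k : κ) :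
    IsStable c a (kerFamily c a U V k) := by
  rintro l v x ⟨hx, hx'⟩
  refine ⟨hU l v x hx, ?_⟩
  have := hV l _ _ hx'
  rw [add_right_comm] at this
  simpa [mul_left_comm] using this

theorem isStable_cokerFamily (hU : IsStable c a U) (hV : IsStable c a V) (k : κ) :
    IsStable c a (cokerFamily c a U V k) := by
  intro l v
  suffices cokerFamily c a U V k v ≤
      (cokerFamily c a U V k (v + Pi.single (c l) 1)).comap (LinearMap.mulLeft R (a l)) from this
  refine sup_le (fun x hx => Submodule.mem_sup_left (hV l v x hx)) (iSup₂_le ?_)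
  rintro w rfl _ ⟨x, hx, rfl⟩
  rw [add_right_comm, Submodule.mem_comap, cokerFamily_add]
  refine Submodule.mem_sup_right ⟨a l * x, hU l _ _ hx, ?_⟩
  simp [mul_left_comm]

variable [Fintype σ]

/-- Induction on the set `act` outside which the variables kill `U / V`. If every direction has an
active variable `a_k`, the exact sequence `0 → K → U/V → (U/V)(e_{c k}) → C → 0` expresses the
difference in that direction through `K` and `C`. Both are killed by `a_k`, so they have fewer
active variables. If some direction has none, the ascending chain condition makes `U / V` vanish far
out in that direction. -/
theorem exists_hilbertPolynomial_of_active [Finite κ] (act : Finset κ)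
    (hNoeth : IsNoetherianFamily c a U) (hU : IsStable c a U) (hV : IsStable c a V) (hVU : V ≤ U)
    (hact : ∀ k ∉ act, ∀ v, ∀ x ∈ U v, a k * x ∈ V (v + Pi.single (c k) 1))
    (hfin : ∃ N : ℕ, ∀ v : σ → ℕ, (∀ i, N ≤ v i) → relLength (U v) (V v) ≠ ⊤) :
    ∃ P, AgreesEventually (fun v => ((relLength (U v) (V v)).toNat : ℚ)) P := by
  classical
  induction act using Finset.strongInduction generalizing U V with
  | H act ih =>
    by_cases hdir : ∀ i, ∃ k ∈ act, c k = i
    · refine exists_agreesEventually_of_differences _ fun i => ?_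
      obtain ⟨k, hk, rfl⟩ := hdir i
      obtain ⟨N, hN⟩ := hfin
      have hlt : act.erase k ⊂ act := Finset.erase_ssubset hk
      have hVK : V ≤ kerFamily c a U V k := fun v x hx => ⟨hVU v hx, hV k v x hx⟩
      have hKU : kerFamily c a U V k ≤ U := fun v => inf_le_left
      have hVC : V ≤ cokerFamily c a U V k := fun v => le_sup_left
      have hCU : cokerFamily c a U V k ≤ U := by
        refine fun v => sup_le (hVU v) (iSup₂_le ?_)
        rintro w rfl _ ⟨x, hx, rfl⟩
        exact hU k w x hx
      have hKfin : ∀ v : σ → ℕ, (∀ i, N ≤ v i) →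
          relLength (kerFamily c a U V k v) (V v) ≠ ⊤ := fun v hv =>
        ne_top_of_le_ne_top (hN v hv) (relLength_mono_left _ (hKU v))
      have hCfin : ∀ v : σ → ℕ, (∀ i, N ≤ v i) →
          relLength (U v) (cokerFamily c a U V k v) ≠ ⊤ := fun v hv =>
        ne_top_of_le_ne_top (hN v hv) (relLength_anti_right _ (hVC v))
      obtain ⟨P, NP, hP⟩ := ih _ hlt (hNoeth.mono hKU) (isStable_kerFamily hU hV k) hV hVK
        (fun l hl v x hx => by
          by_cases hlk : l = k
          · subst hlk; exact hx.2
          · exact hact l (fun h => hl (Finset.mem_erase.2 ⟨hlk, h⟩)) v x hx.1) ⟨N, hKfin⟩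
      obtain ⟨Q, NQ, hQ⟩ := ih _ hlt hNoeth hU (isStable_cokerFamily hU hV k) hCU
        (fun l hl v x hx => by
          by_cases hlk : l = k
          · subst hlk
            rw [cokerFamily_add]
            exact Submodule.mem_sup_right ⟨x, hx, rfl⟩
          · exact hVC _ (hact l (fun h => hl (Finset.mem_erase.2 ⟨hlk, h⟩)) v x hx)) ⟨N, hCfin⟩
      obtain ⟨Q', hQ'⟩ : ∃ Q' : MvPolynomial σ ℚ, ∀ x, MvPolynomial.eval x Q' =
          MvPolynomial.eval (x + Pi.single (c k) 1) Q := by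
        refine ⟨MvPolynomial.aeval (fun j => MvPolynomial.X j +
          MvPolynomial.C ((Pi.single (c k) 1 : σ → ℚ) j)) Q, fun x => ?_⟩
        simp only [← MvPolynomial.coe_aeval_eq_eval, RingHom.coe_coe]
        rw [← AlgHom.comp_apply, MvPolynomial.comp_aeval]
        congr 2
        ext j
        simp
      refine ⟨Q' - P, N + NP + NQ, fun v hv => ?_⟩
      have hle : ∀ j, v j ≤ (v + Pi.single (c k) 1 : σ → ℕ) j := fun j => Nat.le_add_right _ _
      have h1 := relLength_ker_coker (LinearMap.mulLeft R (a k)) (hVU v)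
        (hVU (v + Pi.single (c k) 1)) (fun x hx => hU k v x hx) (fun x hx => hV k v x hx)
      rw [← cokerFamily_add] at h1
      change _ + relLength (kerFamily c a U V k v) (V v) = _ at h1
      have f1 := hN (v + Pi.single (c k) 1) (fun j => (by have := hv j; omega : N ≤ v j).trans (hle j))
      have f2 := hN v (fun j => by have := hv j; omega)
      have f3 := hKfin v (fun j => by have := hv j; omega)
      have f4 := hCfin (v + Pi.single (c k) 1) (fun j => (by have := hv j; omega : N ≤ v j).trans (hle j))
      have h2 := congrArg (fun x => ((ENat.toNat x : ℕ) : ℚ)) h1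
      simp only [ENat.toNat_add f1 f3, ENat.toNat_add f4 f2, Nat.cast_add] at h2
      have h3 := hP v (fun j => by have := hv j; omega)
      have h4 := hQ (v + Pi.single (c k) 1) (fun j => (by have := hv j; omega : NQ ≤ v j).trans (hle j))
      have h5 : (fun i => (((v + Pi.single (c k) 1 : σ → ℕ) i : ℕ) : ℚ)) =
          (fun i => (v i : ℚ)) + Pi.single (c k) 1 := by
        ext j
        by_cases hj : j = c k
        · subst hj; simp
        · simp [hj]
      rw [h5, ← hQ'] at h4
      beta_reduce at h3 h4 ⊢
      rw [map_sub, ← h3, ← h4]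
      linarith
    · push Not at hdir
      obtain ⟨i, hi⟩ := hdir
      -- These truncations are stable: an active variable does not change `v i`, and an inactive one
      -- maps `U` into `V`. When the chain stops at `n₀`, the families `U` and `V` agree wherever `v
      -- i > n₀`.
      let W : ℕ → (σ → ℕ) → Submodule R A := fun n v => if v i ≤ n then U v else V v
      have hW : ∀ n, IsStable c a (W n) := by
        intro n k v x hx
        by_cases hk : k ∈ act
        · have : (v + Pi.single (c k) 1 : σ → ℕ) i = v i := by
            rw [Pi.add_apply, Pi.single_eq_of_ne (hi k hk).symm, add_zero]
          simp only [W, this] at hx ⊢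
          split_ifs at hx ⊢ with h
          · exact hU k v x hx
          · exact hV k v x hx
        · have hx' : x ∈ U v := by
            simp only [W] at hx
            split_ifs at hx
            · exact hx
            · exact hVU v hx
          have := hact k hk v x hx'
          simp only [W]
          split_ifs
          · exact hVU _ this
          · exact this
      obtain ⟨n₀, hn₀⟩ := hNoeth W (fun m n hmn v => by
        simp only [W]
        split_ifs
        · exact le_rfl
        · omega
        · exact hVU v
        · exact le_rfl) hW (fun n v => by
        simp only [W]
        split_ifs
        · exact le_rfl
        · exact hVU v)
      refine ⟨0, n₀ + 1, fun v hv => ?_⟩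
      have h1 := congrFun (hn₀ (n₀ + v i) (Nat.le_add_right _ _)) v
      have h2 : ¬ v i ≤ n₀ := by have := hv i; omega
      simp only [W, if_neg h2, if_pos (Nat.le_add_left (v i) n₀)] at h1
      simp [relLength_eq_zero_iff.2 h1.ge]

/-- The Hilbert polynomial of the `ℕ^σ`-graded module with the parts `U v / V v`. -/
theorem exists_hilbertPolynomial [Finite κ]
    (hNoeth : IsNoetherianFamily c a U) (hU : IsStable c a U) (hV : IsStable c a V) (hVU : V ≤ U)
    (hfin : ∃ N : ℕ, ∀ v : σ → ℕ, (∀ i, N ≤ v i) → relLength (U v) (V v) ≠ ⊤) :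
    ∃ P, AgreesEventually (fun v => ((relLength (U v) (V v)).toNat : ℚ)) P := by
  have := Fintype.ofFinite κ
  exact exists_hilbertPolynomial_of_active Finset.univ hNoeth hU hV hVU
    (fun k hk => absurd (Finset.mem_univ k) hk) hfin

end Families

/-! ### Standard graded algebras -/

section Standard

variable {p : ℕ} {R B : Type*} [CommRing R] [CommRing B] [Algebra R B]
  {𝒜 : (Fin p → ℕ) → Submodule R B}

theorem isNoetherianRing_of_standard [IsNoetherianRing R] (hB : IsStandardGraded 𝒜) :
    IsNoetherianRing B := by
  obtain ⟨s, -, hs⟩ := hB.generated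
  have : Algebra.FiniteType R B := ⟨⟨s, hs⟩⟩
  exact Algebra.FiniteType.isNoetherianRing R B

variable (𝒜) [GradedAlgebra 𝒜]

theorem graded_mul_le (a b : Fin p → ℕ) : 𝒜 a * 𝒜 b ≤ 𝒜 (a + b) :=
  Submodule.mul_le.2 fun _ hx _ hy => SetLike.mul_mem_graded hx hy

theorem prod_pow_le_graded {H : Fin p → Submodule R B} (hH : ∀ i, H i ≤ 𝒜 (Pi.single i 1))
    (n : Fin p → ℕ) : ∏ i, H i ^ n i ≤ 𝒜 n := by
  have h1 : ∀ i, ∀ k : ℕ, H i ^ k ≤ 𝒜 (Pi.single i k) := by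
    intro i k
    induction k with
    | zero =>
      rw [pow_zero, Pi.single_zero, Submodule.one_le]
      exact SetLike.GradedOne.one_mem
    | succ k ih =>
      rw [pow_succ, Pi.single_add]
      exact (mul_le_mul' ih (hH i)).trans (graded_mul_le 𝒜 _ _)
  have h2 : ∀ s : Finset (Fin p), ∏ i ∈ s, H i ^ n i ≤ 𝒜 (∑ i ∈ s, Pi.single i (n i)) := by
    intro s
    induction s using Finset.induction_on with
    | empty =>
      rw [Finset.prod_empty, Finset.sum_empty, Submodule.one_le]
      exact SetLike.GradedOne.one_mem
    | insert i s hi ih =>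
      rw [Finset.prod_insert hi, Finset.sum_insert hi]
      exact (mul_le_mul' (h1 i _) ih).trans (graded_mul_le 𝒜 _ _)
  have := h2 Finset.univ
  rwa [Finset.univ_sum_single] at this

variable {𝒜}

/-- The products `∏ i, G i ^ d i` of the spans of the degree-one generators multiply into each
other, so their sum is a subalgebra containing all generators, hence all of `B`. Comparing
homogeneous components gives equality degree by degree. -/
theorem exists_fg_generators (hB : IsStandardGraded 𝒜) : ∃ G : Fin p → Submodule R B,
    (∀ i, (G i).FG) ∧ ∀ d, 𝒜 d = ∏ i, G i ^ d i := by
  obtain ⟨s, hs, hgen⟩ := hB.generated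
  let G : Fin p → Submodule R B := fun i => Submodule.span R ((s : Set B) ∩ 𝒜 (Pi.single i 1))
  have hG : ∀ i, G i ≤ 𝒜 (Pi.single i 1) := fun i =>
    Submodule.span_le.2 Set.inter_subset_right
  let 𝒞 : (Fin p → ℕ) → Submodule R B := fun d => ∏ i, G i ^ d i
  have h𝒞 : ∀ d, 𝒞 d ≤ 𝒜 d := prod_pow_le_graded 𝒜 hG
  have hmul : ∀ d e, 𝒞 d * 𝒞 e = 𝒞 (d + e) := fun d e => by
    simp only [𝒞, Pi.add_apply, pow_add, Finset.prod_mul_distrib]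
  have hsingle : ∀ i, 𝒞 (Pi.single i 1) = G i := fun i => by
    simp only [𝒞]
    rw [Finset.prod_eq_single i]
    · simp
    · intro j _ hj; simp [hj]
    · simp
  have htop : ∀ x : B, x ∈ ⨆ d, 𝒞 d := by
    intro x
    have hx : x ∈ Algebra.adjoin R (s : Set B) := hgen ▸ Algebra.mem_top
    induction hx using Algebra.adjoin_induction with
    | mem x hx =>
      obtain ⟨i, hi⟩ := hs x hx
      refine Submodule.mem_iSup_of_mem (Pi.single i 1) ?_
      rw [hsingle]
      exact Submodule.subset_span ⟨hx, hi⟩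
    | algebraMap r =>
      refine Submodule.mem_iSup_of_mem 0 ?_
      simp [𝒞]
    | add x y _ _ hx hy => exact add_mem hx hy
    | mul x y _ _ hx hy =>
      have := Submodule.mul_mem_mul hx hy
      rw [Submodule.iSup_mul] at this
      simp_rw [Submodule.mul_iSup, hmul] at this
      exact (iSup_le fun i => iSup_le fun j => le_iSup 𝒞 (i + j)) this
  refine ⟨G, fun i => Submodule.fg_span (s.finite_toSet.subset Set.inter_subset_left), fun d =>
    le_antisymm (fun x hx => ?_) (h𝒞 d)⟩
  have key : ∀ y ∈ ⨆ d, 𝒞 d, (DirectSum.decompose 𝒜 y d : B) ∈ 𝒞 d := by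
    intro y hy
    induction hy using Submodule.iSup_induction' with
    | mem e y hy =>
      by_cases hed : e = d
      · subst hed
        rwa [DirectSum.decompose_of_mem_same 𝒜 (h𝒞 _ hy)]
      · rw [DirectSum.decompose_of_mem_ne 𝒜 (h𝒞 _ hy) hed]
        exact zero_mem _
    | zero => simp
    | add y z _ _ hy hz =>
      rw [DirectSum.decompose_add, DirectSum.add_apply, Submodule.coe_add]
      exact add_mem hy hz
  have := key x (htop x)
  rwa [DirectSum.decompose_of_mem_same 𝒜 hx] at this

theorem graded_mul (hB : IsStandardGraded 𝒜) (a b : Fin p → ℕ) : 𝒜 a * 𝒜 b = 𝒜 (a + b) := by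
  obtain ⟨G, -, hG⟩ := exists_fg_generators hB
  simp only [hG, Pi.add_apply, pow_add, Finset.prod_mul_distrib]

theorem graded_fg (hB : IsStandardGraded 𝒜) (d : Fin p → ℕ) : (𝒜 d).FG := by
  obtain ⟨G, hfg, hG⟩ := exists_fg_generators hB
  have : ∀ s : Finset (Fin p), (∏ i ∈ s, G i ^ d i).FG := by
    intro s
    induction s using Finset.induction_on with
    | empty => rw [Finset.prod_empty, Submodule.one_eq_span]; exact Submodule.fg_span_singleton 1
    | insert i s hi ih => rw [Finset.prod_insert hi]; exact ((hfg i).pow _).mul ih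
  exact hG d ▸ this Finset.univ

/-- Testing primality on homogeneous elements requires a linearly ordered cancellative grading
monoid. The order is an explicit argument because the order carried by `Fin p → ℕ` is the product
order; the next lemma supplies the lexicographic one. -/
theorem exists_homogeneous_of_not_isPrime_of_linearOrder {ι : Type*} [d : DecidableEq ι]
    [AddCommMonoid ι] (𝒜 : ι → Submodule R B) [GradedAlgebra 𝒜] (lo : LinearOrder ι)
    (h : IsOrderedCancelAddMonoid ι) {Q : Ideal B} (hQ : Q.IsHomogeneous 𝒜) (hne : Q ≠ ⊤)
    (hnp : ¬ Q.IsPrime) : ∃ d a e b, a ∈ 𝒜 d ∧ b ∈ 𝒜 e ∧ a * b ∈ Q ∧ a ∉ Q ∧ b ∉ Q := by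
  obtain rfl : d = lo.toDecidableEq := Subsingleton.elim _ _
  by_contra! hall
  refine hnp (hQ.isPrime_of_homogeneous_mem_or_mem hne ?_)
  rintro a b ⟨d, ha⟩ ⟨e, hb⟩ hab
  by_contra! h
  exact h.2 (hall _ a _ b ha hb hab h.1)

theorem exists_homogeneous_of_not_isPrime {Q : Ideal B} (hQ : Q.IsHomogeneous 𝒜) (hne : Q ≠ ⊤)
    (hnp : ¬ Q.IsPrime) : ∃ d a e b, a ∈ 𝒜 d ∧ b ∈ 𝒜 e ∧ a * b ∈ Q ∧ a ∉ Q ∧ b ∉ Q :=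
  @exists_homogeneous_of_not_isPrime_of_linearOrder R B _ _ _ (Fin p → ℕ) _ Pi.addCommMonoid 𝒜 _
    (inferInstance : LinearOrder (Lex (Fin p → ℕ)))
    (inferInstance : IsOrderedCancelAddMonoid (Lex (Fin p → ℕ))) Q hQ hne hnp

end Standard

/-! ### Growth of the lengths of `[B/Q]_w` modulo `𝔪^s`, and the dimension of `MultiProj` -/

section Growth

variable {p : ℕ} {R B : Type*} [CommRing R] [CommRing B] [Algebra R B]

/-- The annihilator of `a` in `B / Q`. -/
def elementColon (Q : Ideal B) (a : B) : Ideal B := Submodule.comap (LinearMap.mulLeft B a) Q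

theorem mem_elementColon {Q : Ideal B} {a x : B} : x ∈ elementColon Q a ↔ a * x ∈ Q := Iff.rfl

theorem le_elementColon (Q : Ideal B) (a : B) : Q ≤ elementColon Q a :=
  fun _ hx => Q.mul_mem_left a hx

theorem elementColon_eq_of_isPrime {Q : Ideal B} (hQ : Q.IsPrime) {a : B} (ha : a ∉ Q) :
    elementColon Q a = Q :=
  le_antisymm (fun _ hx => (hQ.mem_or_mem hx).resolve_left ha) (le_elementColon Q a)

variable (𝒜 : (Fin p → ℕ) → Submodule R B) (𝔪 : Ideal R)

/-- The length of the part of degree `w` of `B / (Q + 𝔪^s B)`. -/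
noncomputable def truncLength (Q : Ideal B) (w : Fin p → ℕ) (s : ℕ) : ℕ∞ :=
  relLength (𝒜 w) (Q.restrictScalars R ⊓ 𝒜 w ⊔ 𝔪 ^ s • 𝒜 w)

theorem truncLength_zero (Q : Ideal B) (w : Fin p → ℕ) : truncLength 𝒜 𝔪 Q w 0 = 0 := by
  rw [truncLength, relLength_eq_zero_iff, pow_zero, Ideal.one_eq_top, Submodule.top_smul]
  exact le_sup_right

theorem truncLength_eq_zero {Q : Ideal B} {w : Fin p → ℕ} (h : 𝒜 w ≤ Q.restrictScalars R) (s : ℕ) :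
    truncLength 𝒜 𝔪 Q w s = 0 := by
  rw [truncLength, relLength_eq_zero_iff]
  exact le_sup_of_le_left (le_inf h le_rfl)

theorem truncLength_le_one {Q : Ideal B} (h : ∀ y ∈ 𝔪, algebraMap R B y ∈ Q) (w : Fin p → ℕ)
    (s : ℕ) : truncLength 𝒜 𝔪 Q w s ≤ truncLength 𝒜 𝔪 Q w 1 := by
  refine relLength_anti_right _ (sup_le le_sup_left (le_sup_of_le_left ?_))
  rw [pow_one]
  refine Submodule.smul_le.2 fun y hy b hb => ⟨?_, Submodule.smul_mem _ _ hb⟩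
  rw [Algebra.smul_def]
  exact Q.mul_mem_right _ (h y hy)

variable [GradedAlgebra 𝒜]
variable {𝒜} {𝔪}

theorem isHomogeneous_elementColon {Q : Ideal B} (hQ : Q.IsHomogeneous 𝒜) {d : Fin p → ℕ} {a : B}
    (ha : a ∈ 𝒜 d) : (elementColon Q a).IsHomogeneous 𝒜 := by
  intro i x hx
  have := hQ (d + i) (mem_elementColon.1 hx)
  rwa [DirectSum.coe_decompose_mul_add_of_left_mem 𝒜 ha] at this

theorem isHomogeneous_sup_span_singleton {Q : Ideal B} (hQ : Q.IsHomogeneous 𝒜) {d : Fin p → ℕ}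
    {a : B} (ha : a ∈ 𝒜 d) : (Q ⊔ Ideal.span {a}).IsHomogeneous 𝒜 :=
  hQ.sup (Ideal.homogeneous_span 𝒜 _ (by rintro _ rfl; exact ⟨d, ha⟩))

/-- This is the right exact sequence `B/(Q : a) → B/Q → B/(Q + (a)) → 0`, the first map being
multiplication by `a`. The two exponents `s` and `s'` are kept apart so that it covers both a
homogeneous `a` with `s' = s` and an element of `𝔪`, of degree `0`, with `s' = s + 1`. -/
theorem truncLength_le_add {Q : Ideal B} (hQ : Q.IsHomogeneous 𝒜) {d : Fin p → ℕ} {a : B}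
    (ha : a ∈ 𝒜 d) (w : Fin p → ℕ) {s s' : ℕ}
    (hs : 𝔪 ^ s • 𝒜 w ≤ (𝔪 ^ s' • 𝒜 (w + d)).comap (LinearMap.mulLeft R a)) :
    truncLength 𝒜 𝔪 Q (w + d) s' ≤
      truncLength 𝒜 𝔪 (Q ⊔ Ideal.span {a}) (w + d) s' + truncLength 𝒜 𝔪 (elementColon Q a) w s := by
  have hmul : ∀ x ∈ 𝒜 w, a * x ∈ 𝒜 (w + d) := fun x hx => by
    rw [add_comm]; exact SetLike.mul_mem_graded ha hx
  set V : Submodule R B := Q.restrictScalars R ⊓ 𝒜 (w + d) ⊔ 𝔪 ^ s' • 𝒜 (w + d) with hV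
  have h1 : V ≤ V ⊔ (𝒜 w).map (LinearMap.mulLeft R a) := le_sup_left
  have h2 : V ⊔ (𝒜 w).map (LinearMap.mulLeft R a) ≤ 𝒜 (w + d) := by
    refine sup_le (sup_le inf_le_right Submodule.smul_le_right) ?_
    rintro _ ⟨x, hx, rfl⟩
    exact hmul x hx
  rw [truncLength, ← hV, relLength_add h1 h2]
  refine add_le_add (relLength_anti_right _ (sup_le ?_ (le_sup_of_le_left le_sup_right))) ?_
  · rintro x ⟨hx, hxd⟩
    obtain ⟨q, hq, z, hz, rfl⟩ := Submodule.mem_sup.1 (hx : x ∈ Q ⊔ Ideal.span {a})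
    obtain ⟨b, rfl⟩ := Ideal.mem_span_singleton'.1 hz
    rw [← DirectSum.decompose_of_mem_same 𝒜 hxd, DirectSum.decompose_add, DirectSum.add_apply,
      Submodule.coe_add, DirectSum.coe_decompose_mul_add_of_right_mem 𝒜 ha, mul_comm]
    exact add_mem (Submodule.mem_sup_left (Submodule.mem_sup_left ⟨hQ _ hq, SetLike.coe_mem _⟩))
      (Submodule.mem_sup_right ⟨_, SetLike.coe_mem _, rfl⟩)
  · refine relLength_le_of_map (LinearMap.mulLeft R a) (fun u hu => ?_) (fun u _ hu => ?_)
      (fun y hy => ?_)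
    · exact Submodule.mem_sup_right ⟨u, hu, rfl⟩
    · obtain ⟨x, hx, z, hz, rfl⟩ := Submodule.mem_sup.1 hu
      rw [map_add]
      exact add_mem (Submodule.mem_sup_left ⟨hx.1, hmul _ hx.2⟩) (Submodule.mem_sup_right (hs hz))
    · obtain ⟨z, hz, _, ⟨x, hx, rfl⟩, rfl⟩ := Submodule.mem_sup.1 hy
      exact ⟨x, hx, by simpa using hz⟩

theorem truncLength_add_degree_le {Q : Ideal B} (hQ : Q.IsHomogeneous 𝒜) {d : Fin p → ℕ} {a : B}
    (ha : a ∈ 𝒜 d) (w : Fin p → ℕ) (s : ℕ) :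
    truncLength 𝒜 𝔪 Q (w + d) s ≤
      truncLength 𝒜 𝔪 (Q ⊔ Ideal.span {a}) (w + d) s + truncLength 𝒜 𝔪 (elementColon Q a) w s := by
  refine truncLength_le_add hQ ha w (Submodule.smul_le.2 fun r hr b hb => ?_)
  rw [Submodule.mem_comap, map_smul]
  refine Submodule.smul_mem_smul hr ?_
  rw [add_comm]
  exact SetLike.mul_mem_graded ha hb

theorem truncLength_succ_le {Q : Ideal B} (hQ : Q.IsHomogeneous 𝒜) {y : R} (hy : y ∈ 𝔪)
    (w : Fin p → ℕ) (s : ℕ) :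
    truncLength 𝒜 𝔪 Q w (s + 1) ≤ truncLength 𝒜 𝔪 (Q ⊔ Ideal.span {algebraMap R B y}) w (s + 1) +
      truncLength 𝒜 𝔪 (elementColon Q (algebraMap R B y)) w s := by
  have := truncLength_le_add (𝔪 := 𝔪) (s := s) (s' := s + 1) hQ (SetLike.algebraMap_mem_graded 𝒜 y)
    w (Submodule.smul_le.2 fun r hr b hb => by
      rw [Submodule.mem_comap, map_smul, LinearMap.mulLeft_apply, ← Algebra.smul_def, smul_smul,
        add_zero, pow_succ]
      exact Submodule.smul_mem_smul (Ideal.mul_mem_mul hr hy) hb)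
  rwa [add_zero] at this

/-- `N / 𝔪N` is a finite-dimensional vector space over the residue field. -/
theorem relLength_smul_ne_top [IsLocalRing R] {M : Type*} [AddCommGroup M] [Module R M]
    {N : Submodule R M} (hN : N.FG) :
    relLength N (IsLocalRing.maximalIdeal R • N) ≠ ⊤ := by
  have : Module.Finite R N := Module.Finite.iff_fg.2 hN
  let 𝔪 := IsLocalRing.maximalIdeal R
  let K : Submodule R N := 𝔪 • ⊤
  have hK : K ≤ (𝔪 • N).submoduleOf N :=
    Submodule.smul_le.2 fun r hr n _ => Submodule.smul_mem_smul hr n.2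
  have h1 : relLength N (𝔪 • N) ≤ Module.length R (N ⧸ K) :=
    Module.length_le_of_surjective (Submodule.factor hK) (Submodule.factor_surjective hK)
  refine ne_top_of_le_ne_top ?_ h1
  let _ : Field (R ⧸ 𝔪) := Ideal.Quotient.field 𝔪
  have : Module.Finite (R ⧸ 𝔪) (N ⧸ K) := Module.Finite.of_restrictScalars_finite R _ _
  rw [Module.length_eq_of_surjective (S := R) (R := R ⧸ 𝔪) Ideal.Quotient.mk_surjective]
  exact Module.length_ne_top

theorem relLength_pow_smul_ne_top [IsLocalRing R] [IsNoetherianRing R] {M : Type*} [AddCommGroup M]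
    [Module R M] {N : Submodule R M} (hN : N.FG) (s : ℕ) :
    relLength N (IsLocalRing.maximalIdeal R ^ s • N) ≠ ⊤ := by
  induction s with
  | zero =>
    rw [relLength_eq_zero_iff.2 (by rw [pow_zero, Ideal.one_eq_top, Submodule.top_smul])]
    exact ENat.zero_ne_top
  | succ s ih =>
    have h : IsLocalRing.maximalIdeal R ^ (s + 1) • N ≤ IsLocalRing.maximalIdeal R ^ s • N :=
      Submodule.smul_mono_left (Ideal.pow_le_pow_right (Nat.le_succ s))
    rw [relLength_add h Submodule.smul_le_right]
    refine WithTop.add_ne_top.2 ⟨ih, ?_⟩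
    rw [pow_succ', Submodule.mul_smul]
    exact relLength_smul_ne_top (Submodule.FG.smul (IsNoetherian.noetherian _) hN)

/-- The function `x ↦ x ^ (e - 1)`, except that it is zero for `e = 0`. -/
def growth : ℕ → ℕ → ℕ
  | 0, _ => 0
  | e + 1, x => x ^ e

theorem growth_mono (e : ℕ) : Monotone (growth e) := by
  intro x y h
  cases e with
  | zero => exact le_rfl
  | succ e => exact Nat.pow_le_pow_left h e

theorem mul_growth_le (e x : ℕ) : x * growth e x ≤ growth (e + 1) x := by
  cases e with
  | zero => simp [growth]
  | succ e => simp only [growth]; rw [pow_succ']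

/-- The lengths of the parts of `B / (Q + 𝔪^s B)` are bounded by a multiple of `growth e`. -/
def HasGrowth (𝒜 : (Fin p → ℕ) → Submodule R B) (𝔪 : Ideal R) (Q : Ideal B) (e : ℕ) : Prop :=
  ∃ N C : ℕ, ∀ w : Fin p → ℕ, (∀ i, N ≤ w i) → ∀ s : ℕ,
    truncLength 𝒜 𝔪 Q w s ≤ (C * growth e (∑ i, w i + s + 1) : ℕ)

theorem HasGrowth.of_colon {Q : Ideal B} (hQ : Q.IsHomogeneous 𝒜) {d : Fin p → ℕ} {a : B}
    (ha : a ∈ 𝒜 d) {e : ℕ} (h₁ : HasGrowth 𝒜 𝔪 (Q ⊔ Ideal.span {a}) e)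
    (h₂ : HasGrowth 𝒜 𝔪 (elementColon Q a) e) : HasGrowth 𝒜 𝔪 Q e := by
  obtain ⟨N₁, C₁, h₁⟩ := h₁
  obtain ⟨N₂, C₂, h₂⟩ := h₂
  refine ⟨N₁ + N₂ + ∑ i, d i, C₁ + C₂, fun w hw s => ?_⟩
  have hd : ∀ i, d i ≤ ∑ i, d i := fun i => Finset.single_le_sum (fun _ _ => Nat.zero_le _)
    (Finset.mem_univ i)
  obtain ⟨w', rfl⟩ : ∃ w', w = w' + d := ⟨w - d, funext fun i => by
    have := hw i; have := hd i; simp only [Pi.add_apply, Pi.sub_apply]; omega⟩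
  refine (truncLength_add_degree_le hQ ha w' s).trans ?_
  rw [add_mul, Nat.cast_add]
  refine add_le_add (h₁ _ (fun i => by have := hw i; omega) s)
    ((h₂ w' (fun i => by have := hw i; have := hd i; rw [Pi.add_apply] at *; omega) s).trans ?_)
  refine Nat.cast_le.2 (Nat.mul_le_mul_left _ (growth_mono e ?_))
  have : ∑ i, w' i ≤ ∑ i, (w' + d) i := Finset.sum_le_sum fun i _ => Nat.le_add_right _ _
  omega

/-- For a prime `Q` not containing `x_i` the colon ideal `Q : x_i` is `Q`, so lowering `w` by `e_i`
costs only the length for `Q + (x_i)`. The number `k` bounds the steps down to the corner `(N, …,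
N)`. -/
theorem truncLength_le_of_steps {Q : Ideal B} (hQ : Q.IsHomogeneous 𝒜) (hprime : Q.IsPrime)
    {x : Fin p → B} (hx : ∀ i, x i ∈ 𝒜 (Pi.single i 1)) (hxQ : ∀ i, x i ∉ Q) {e : ℕ} {N C : ℕ}
    (h : ∀ i, ∀ w : Fin p → ℕ, (∀ i, N ≤ w i) → ∀ s : ℕ,
      truncLength 𝒜 𝔪 (Q ⊔ Ideal.span {x i}) w s ≤ (C * growth e (∑ i, w i + s + 1) : ℕ))
    (s k : ℕ) (w : Fin p → ℕ) (hw : ∀ i, N ≤ w i) (hk : ∑ i, w i ≤ k + ∑ _i : Fin p, N) :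
    truncLength 𝒜 𝔪 Q w s ≤ (k * (C * growth e (∑ i, w i + s + 1)) : ℕ) +
      truncLength 𝒜 𝔪 Q (fun _ => N) s := by
  induction k generalizing w with
  | zero =>
    obtain rfl : w = fun _ => N := by
      by_contra hne
      obtain ⟨i, hi⟩ := Function.ne_iff.1 hne
      have : ∑ _i : Fin p, N < ∑ i, w i := Finset.sum_lt_sum (fun i _ => hw i)
        ⟨i, Finset.mem_univ i, lt_of_le_of_ne (hw i) (Ne.symm hi)⟩
      omega
    exact le_add_self
  | succ k ih =>
    by_cases hne : w = fun _ => N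
    · subst hne; exact le_add_self
    · obtain ⟨i, hi⟩ := Function.ne_iff.1 hne
      obtain ⟨w', rfl⟩ : ∃ w', w = w' + Pi.single i 1 := ⟨w - Pi.single i 1, funext fun j => by
        by_cases hj : j = i
        · subst hj
          have := hw j
          simp only [Pi.add_apply, Pi.sub_apply, Pi.single_eq_same]
          omega
        · simp [hj]⟩
      have hw' : ∀ j, N ≤ w' j := fun j => by
        by_cases hj : j = i
        · subst hj
          have := hw j
          simp only [Pi.add_apply, Pi.single_eq_same] at this hi
          omega
        · simpa [hj] using hw j
      have hsum : ∑ j, (w' + Pi.single i 1 : Fin p → ℕ) j = ∑ j, w' j + 1 := by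
        simp [Finset.sum_add_distrib]
      have h1 := truncLength_add_degree_le (𝔪 := 𝔪) hQ (hx i) w' s
      rw [elementColon_eq_of_isPrime hprime (hxQ i)] at h1
      refine h1.trans ((add_le_add (h i _ hw s) (ih w' hw' (by omega))).trans ?_)
      rw [← add_assoc, ← Nat.cast_add]
      refine add_le_add (Nat.cast_le.2 ?_) le_rfl
      rw [add_mul, one_mul, add_comm]
      refine Nat.add_le_add_right (Nat.mul_le_mul_left _ (Nat.mul_le_mul_left _
        (growth_mono e ?_))) _
      omega

/-- The same descent in the exponent `s`, with an element of `𝔪` in place of the `x_i`; it ends at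
`s = 0`, where the length is zero. -/
theorem truncLength_le_of_smul_steps {Q : Ideal B} (hQ : Q.IsHomogeneous 𝒜) (hprime : Q.IsPrime)
    {y : R} (hy : y ∈ 𝔪) (hyQ : algebraMap R B y ∉ Q) {e : ℕ} {C : ℕ} {w : Fin p → ℕ}
    (h : ∀ s : ℕ, truncLength 𝒜 𝔪 (Q ⊔ Ideal.span {algebraMap R B y}) w s ≤
      (C * growth e (∑ i, w i + s + 1) : ℕ)) (s : ℕ) :
    truncLength 𝒜 𝔪 Q w s ≤ (s * (C * growth e (∑ i, w i + s + 1)) : ℕ) := by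
  induction s with
  | zero => rw [truncLength_zero]; exact zero_le
  | succ s ih =>
    have h1 := truncLength_succ_le hQ hy w s
    rw [elementColon_eq_of_isPrime hprime hyQ] at h1
    refine h1.trans ((add_le_add (h (s + 1)) ih).trans ?_)
    rw [← Nat.cast_add, add_mul s 1, one_mul, add_comm (s * _)]
    refine Nat.cast_le.2 (Nat.add_le_add_left (Nat.mul_le_mul_left _ (Nat.mul_le_mul_left _
      (growth_mono e ?_))) _)
    omega

/-- One descends first in `w` to a fixed corner, then in `s`. The number of steps is at most linear
in `|w| + s`, and each costs a length for a strictly larger ideal, so the exponent rises by one. -/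
theorem hasGrowth_of_isPrime [IsLocalRing R] [IsNoetherianRing R] (hB : IsStandardGraded 𝒜)
    {Q : Ideal B} (hQ : Q.IsHomogeneous 𝒜) (hprime : Q.IsPrime)
    (hirr : ¬ irrelevantIdeal 𝒜 ≤ Q) {e : ℕ}
    (h : ∀ Q' : Ideal B, Q'.IsHomogeneous 𝒜 → Q < Q' →
      HasGrowth 𝒜 (IsLocalRing.maximalIdeal R) Q' e) :
    HasGrowth 𝒜 (IsLocalRing.maximalIdeal R) Q (e + 1) := by
  set 𝔪 := IsLocalRing.maximalIdeal R
  -- If `Q` contained some `[B]_{e_i}`, it would contain every `[B]_d` with `d i ≥ 1`, hence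
  -- `B_{++}`.
  have hx : ∀ i, ∃ x ∈ 𝒜 (Pi.single i 1), x ∉ Q := by
    intro i
    by_contra! hall
    refine hirr (Ideal.span_le.2 ?_)
    rintro b ⟨d, hd, hb⟩
    obtain ⟨d', rfl⟩ : ∃ d', d = Pi.single i 1 + d' := ⟨d - Pi.single i 1, funext fun j => by
      have := hd j
      by_cases hj : j = i
      · subst hj
        simp only [Pi.add_apply, Pi.sub_apply, Pi.single_eq_same]
        omega
      · simp [hj]⟩
    rw [← graded_mul hB] at hb
    have hle : 𝒜 (Pi.single i 1) * 𝒜 d' ≤ Q.restrictScalars R :=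
      Submodule.mul_le.2 fun a ha c _ => Q.mul_mem_right _ (hall a ha)
    exact hle hb
  choose x hx hxQ using hx
  have hlt : ∀ {a : B}, a ∉ Q → Q < Q ⊔ Ideal.span {a} := fun {a} ha =>
    lt_of_le_of_ne le_sup_left fun heq =>
      ha (heq ▸ Ideal.mem_sup_right (Ideal.mem_span_singleton_self a))
  choose N C hNC using fun i => h _ (isHomogeneous_sup_span_singleton hQ (hx i)) (hlt (hxQ i))
  -- The behaviour in `s` at a fixed degree: if `𝔪` maps into `Q`, the truncation no longer depends
  -- on `s ≥ 1` and a constant `c₀` suffices; otherwise some `y ∈ 𝔪` outside `Q` allows the descent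
  -- in `s`.
  have hbase : ∃ N₀, ∀ w : Fin p → ℕ, (∀ i, N₀ ≤ w i) → ∃ C₀ c₀ : ℕ, ∀ s,
      truncLength 𝒜 𝔪 Q w s ≤ (s * (C₀ * growth e (∑ i, w i + s + 1)) + c₀ : ℕ) := by
    by_cases hm : ∀ y ∈ 𝔪, algebraMap R B y ∈ Q
    · refine ⟨0, fun w _ => ?_⟩
      have hfin : truncLength 𝒜 𝔪 Q w 1 ≠ ⊤ :=
        ne_top_of_le_ne_top (relLength_pow_smul_ne_top (graded_fg hB w) 1)
          (relLength_anti_right _ le_sup_right)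
      obtain ⟨c₀, hc₀⟩ := ENat.ne_top_iff_exists.1 hfin
      refine ⟨0, c₀, fun s => (truncLength_le_one 𝒜 𝔪 hm w s).trans ?_⟩
      rw [← hc₀]
      simp
    · push Not at hm
      obtain ⟨y, hy, hyQ⟩ := hm
      obtain ⟨N₀, C₀, h₀⟩ := h _ (isHomogeneous_sup_span_singleton hQ
        (SetLike.algebraMap_mem_graded 𝒜 y)) (hlt hyQ)
      exact ⟨N₀, fun w hw => ⟨C₀, 0, fun s => by
        simpa using truncLength_le_of_smul_steps hQ hprime hy hyQ (h₀ w hw) s⟩⟩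
  obtain ⟨N₀, h₀⟩ := hbase
  let M := N₀ + ∑ i, N i
  have hM : ∀ i, N i ≤ M := fun i => (Finset.single_le_sum (f := N) (fun _ _ => Nat.zero_le _)
    (Finset.mem_univ i)).trans (Nat.le_add_left _ _)
  obtain ⟨C₀, c₀, h₀⟩ := h₀ (fun _ => M) fun _ => Nat.le_add_right _ _
  let D := ∑ i, C i
  have hD : ∀ i, C i ≤ D := fun i => Finset.single_le_sum (f := C) (fun _ _ => Nat.zero_le _)
    (Finset.mem_univ i)
  refine ⟨M, D + C₀ + c₀, fun w hw s => ?_⟩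
  have h1 := truncLength_le_of_steps (𝔪 := 𝔪) (N := M) (C := D) (e := e) hQ hprime hx hxQ
    (fun i w hw s => (hNC i w (fun j => (hM i).trans (hw j)) s).trans
      (Nat.cast_le.2 (Nat.mul_le_mul_right _ (hD i)))) s (∑ i, w i) w hw (Nat.le_add_right _ _)
  refine h1.trans ((add_le_add le_rfl (h₀ s)).trans ?_)
  rw [← Nat.cast_add]
  refine Nat.cast_le.2 ?_
  have hMw : ∑ _i : Fin p, M ≤ ∑ i, w i := Finset.sum_le_sum fun i _ => hw i
  set T := ∑ i, w i + s + 1 with hT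
  have g1 : growth e (∑ _i : Fin p, M + s + 1) ≤ growth e T := growth_mono e (by omega)
  have g2 := mul_growth_le e T
  -- The summand `1` in the argument of `growth` makes `T` positive, so that the constant `c₀` is
  -- absorbed.
  have g3 : 1 ≤ growth (e + 1) T := Nat.one_le_pow _ _ (by omega)
  have g4 : (∑ i, w i) * (D * growth e T) ≤ D * growth (e + 1) T := by
    calc (∑ i, w i) * (D * growth e T) = D * ((∑ i, w i) * growth e T) := by ring
      _ ≤ D * (T * growth e T) := by gcongr; omega
      _ ≤ _ := by gcongr
  have g5 : s * (C₀ * growth e (∑ _i : Fin p, M + s + 1)) ≤ C₀ * growth (e + 1) T := by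
    calc s * (C₀ * growth e (∑ _i : Fin p, M + s + 1)) ≤ T * (C₀ * growth e T) := by
          gcongr; omega
      _ = C₀ * (T * growth e T) := by ring
      _ ≤ _ := by gcongr
  have g6 : c₀ ≤ c₀ * growth (e + 1) T := Nat.le_mul_of_pos_right _ g3
  calc _ ≤ D * growth (e + 1) T + (C₀ * growth (e + 1) T + c₀ * growth (e + 1) T) := by omega
    _ = _ := by ring

/-- Noetherian induction on `Q`. If `Q` contains `B_{++}`, the lengths vanish in positive degrees.
If `Q` is prime, it is a point of `MultiProj`, and the points over a larger ideal have smaller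
coheight. Otherwise there are homogeneous `a, b ∉ Q` with `a b ∈ Q`, and both `Q + (a)` and `Q : a`
are strictly larger. -/
theorem hasGrowth_of_coheight_lt [IsLocalRing R] [IsNoetherianRing R] (hB : IsStandardGraded 𝒜)
    (Q : Ideal B) (hQ : Q.IsHomogeneous 𝒜) (e : ℕ)
    (h : ∀ P : MultiProj 𝒜, Q ≤ P.1.asIdeal → Order.coheight P < e) :
    HasGrowth 𝒜 (IsLocalRing.maximalIdeal R) Q e := by
  have := isNoetherianRing_of_standard hB
  induction Q using IsWellFounded.induction (· > · : Ideal B → Ideal B → Prop) generalizing e with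
  | ind Q ih =>
    by_cases hirr : irrelevantIdeal 𝒜 ≤ Q
    · refine ⟨1, 0, fun w hw s => ?_⟩
      rw [truncLength_eq_zero 𝒜 _ (fun b hb => hirr (Ideal.subset_span ⟨w, hw, hb⟩))]
      exact zero_le
    by_cases hprime : Q.IsPrime
    · let P : MultiProj 𝒜 := ⟨⟨Q, hprime⟩, hQ, hirr⟩
      have hP := h P le_rfl
      obtain ⟨c, hc⟩ := ENat.ne_top_iff_exists.1 (ne_top_of_lt hP)
      rw [← hc] at hP
      obtain ⟨e, rfl⟩ : ∃ e', e = e' + 1 := ⟨e - 1, by have := Nat.cast_lt.1 hP; omega⟩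
      refine hasGrowth_of_isPrime hB hQ hprime hirr fun Q' hQ' hlt => ih Q' hlt hQ' e fun P' hP' => ?_
      have hPP' : P < P' := (PrimeSpectrum.asIdeal_lt_asIdeal P.1 P'.1).1 (lt_of_lt_of_le hlt hP')
      have h1 := Order.coheight_add_one_le hPP'
      rw [← hc] at h1
      have h2 : Order.coheight P' + 1 < (e + 1 : ℕ) := lt_of_le_of_lt h1 hP
      have h3 : Order.coheight P' ≠ ⊤ := by
        intro h; rw [h] at h2; simp at h2
      obtain ⟨c', hc'⟩ := ENat.ne_top_iff_exists.1 h3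
      rw [← hc'] at h2 ⊢
      have : c' + 1 < e + 1 := by exact_mod_cast h2
      exact_mod_cast (by omega : c' < e)
    · have hne : Q ≠ ⊤ := fun h => hirr (h ▸ le_top)
      obtain ⟨d, a, d', b, ha, hb, hab, haQ, hbQ⟩ :=
        exists_homogeneous_of_not_isPrime hQ hne hprime
      have h1 : Q < Q ⊔ Ideal.span {a} := lt_of_le_of_ne le_sup_left fun heq =>
        haQ (heq ▸ Ideal.mem_sup_right (Ideal.mem_span_singleton_self a))
      have h2 : Q < elementColon Q a := lt_of_le_of_ne (le_elementColon Q a) fun heq =>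
        hbQ (heq ▸ hab)
      exact HasGrowth.of_colon hQ ha
        (ih _ h1 (isHomogeneous_sup_span_singleton hQ ha) e fun P hP => h P (h1.le.trans hP))
        (ih _ h2 (isHomogeneous_elementColon hQ ha) e fun P hP => h P (h2.le.trans hP))

/-- Sending a point to its closure reverses inclusions of primes strictly, so chains of graded
primes give chains of irreducible closed sets. Only this inequality is needed. -/
theorem coheight_le_topologicalKrullDim (P : MultiProj 𝒜) :
    (Order.coheight P : WithBot ℕ∞) ≤ topologicalKrullDim (MultiProj 𝒜) := by
  refine (Order.coheight_le_krullDim P).trans ?_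
  rw [topologicalKrullDim, ← Order.krullDim_orderDual]
  let f : (MultiProj 𝒜)ᵒᵈ → TopologicalSpace.IrreducibleCloseds (MultiProj 𝒜) := fun x =>
    { carrier := closure {OrderDual.ofDual x}
      isIrreducible' := isIrreducible_singleton.closure
      isClosed' := isClosed_closure }
  refine Order.krullDim_le_of_strictMono f fun x y hxy => ?_
  have key : ∀ a b : MultiProj 𝒜, closure {a} ⊆ closure {b} ↔ b ≤ a := fun a b => by
    rw [← specializes_iff_closure_subset, subtype_specializes_iff,
      ← PrimeSpectrum.le_iff_specializes, Subtype.coe_le_coe]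
  have hlt : OrderDual.ofDual y < OrderDual.ofDual x := hxy
  exact lt_of_le_not_ge ((key _ _).2 hlt.le) fun h => hlt.not_ge ((key _ _).1 h)

end Growth

/-! ### Polynomials with prescribed coefficient modules -/

section CoeffSubmodule

variable {R B τ : Type*} [CommRing R] [CommRing B] [Algebra R B]

/-- The polynomials whose coefficient at `m` lies in `G m`, for all `m`. -/
def coeffSubmodule (G : (τ →₀ ℕ) → Submodule R B) : Submodule R (MvPolynomial τ B) where
  carrier := {f | ∀ m, f.coeff m ∈ G m}
  add_mem' hf hg m := by rw [MvPolynomial.coeff_add]; exact add_mem (hf m) (hg m)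
  zero_mem' m := by rw [MvPolynomial.coeff_zero]; exact zero_mem _
  smul_mem' r f hf m := by rw [MvPolynomial.coeff_smul]; exact Submodule.smul_mem _ r (hf m)

theorem coeffSubmodule_mono {G G' : (τ →₀ ℕ) → Submodule R B} (h : ∀ m, G m ≤ G' m) :
    coeffSubmodule G ≤ coeffSubmodule G' := fun _ hf m => h m (hf m)

theorem monomial_mem_coeffSubmodule {G : (τ →₀ ℕ) → Submodule R B} {m : τ →₀ ℕ} {b : B}
    (hb : b ∈ G m) : MvPolynomial.monomial m b ∈ coeffSubmodule G := by
  classical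
  intro m'
  rw [MvPolynomial.coeff_monomial]
  split_ifs with h
  · exact h ▸ hb
  · exact zero_mem _

theorem relLength_coeffSubmodule (s : Finset (τ →₀ ℕ)) (G G' : (τ →₀ ℕ) → Submodule R B)
    (hle : ∀ m, G' m ≤ G m) (hs : ∀ m ∉ s, G m ≤ G' m) :
    relLength (coeffSubmodule G) (coeffSubmodule G') = ∑ m ∈ s, relLength (G m) (G' m) := by
  classical
  induction s using Finset.induction_on generalizing G with
  | empty =>
    rw [Finset.sum_empty, relLength_eq_zero_iff]
    exact coeffSubmodule_mono fun m => hs m (Finset.notMem_empty m)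
  | insert a s ha ih =>
    -- Passing from `G` to `G₁` changes only the coefficient at `a`, and the coefficient map
    -- identifies that step with `G a / G' a`.
    let G₁ : (τ →₀ ℕ) → Submodule R B := fun m => if m = a then G' a else G m
    have h₁ : ∀ m, G' m ≤ G₁ m := fun m => by
      simp only [G₁]
      split_ifs with h
      · rw [h]
      · exact hle m
    have h₂ : ∀ m, G₁ m ≤ G m := fun m => by
      simp only [G₁]
      split_ifs with h
      · rw [h]; exact hle a
      · exact le_rfl
    rw [relLength_add (coeffSubmodule_mono h₁) (coeffSubmodule_mono h₂), Finset.sum_insert ha,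
      ih G₁ h₁ fun m hm => ?_]
    · congr 1
      · refine (relLength_eq_of_map (U := coeffSubmodule G) (V := coeffSubmodule G₁) (U' := G a)
          (V' := G' a) ((MvPolynomial.lcoeff B a).restrictScalars R)
          (fun f hf => hf a) (fun f hf => ⟨fun h m => ?_, fun h => ?_⟩) fun y hy => ?_).symm
        · by_cases hm : m = a
          · subst hm; simpa [G₁] using h
          · simpa [G₁, hm] using hf m
        · simpa [G₁] using h a
        · exact ⟨MvPolynomial.monomial a y, monomial_mem_coeffSubmodule hy, by simp⟩
      · refine Finset.sum_congr rfl fun m hm => ?_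
        have : m ≠ a := fun h => ha (h ▸ hm)
        simp [G₁, this]
    · by_cases hma : m = a
      · simp [G₁, hma]
      · simpa [G₁, hma] using hs m (by simp [hma, hm])

end CoeffSubmodule

/-! ### Induction on multi-indices -/

theorem exists_eq_add_single {p k : ℕ} {n : Fin p → ℕ} (h : ∑ i, n i = k + 1) :
    ∃ (n' : Fin p → ℕ) (i : Fin p), n = n' + Pi.single i 1 ∧ ∑ i, n' i = k := by
  obtain ⟨i, -, hi⟩ := Finset.exists_ne_zero_of_sum_ne_zero (by omega : ∑ i, n i ≠ 0)
  obtain ⟨n', rfl⟩ : ∃ n', n = n' + Pi.single i 1 := ⟨n - Pi.single i 1, funext fun j => by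
    by_cases hj : j = i
    · subst hj
      simp only [Pi.add_apply, Pi.sub_apply, Pi.single_eq_same]
      omega
    · simp [hj]⟩
  exact ⟨n', i, rfl, by simpa [Finset.sum_add_distrib] using h⟩

theorem pi_nat_induction {p : ℕ} {P : (Fin p → ℕ) → Prop} (zero : P 0)
    (add : ∀ n i, P n → P (n + Pi.single i 1)) (n : Fin p → ℕ) : P n := by
  induction hk : ∑ i, n i generalizing n with
  | zero =>
    obtain rfl : n = 0 := funext fun i => (Finset.sum_eq_zero_iff.1 hk) i (Finset.mem_univ i)
    exact zero
  | succ k ih =>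
    obtain ⟨n', i, rfl, h⟩ := exists_eq_add_single hk
    exact add n' i (ih n' h)

theorem prod_pow_add_single {p : ℕ} {M : Type*} [CommSemiring M] (H : Fin p → M) (n : Fin p → ℕ)
    (i : Fin p) : ∏ j, H j ^ (n + Pi.single i 1 : Fin p → ℕ) j = H i * ∏ j, H j ^ n j := by
  simp only [Pi.add_apply, pow_add, Finset.prod_mul_distrib]
  rw [mul_comm, Finset.prod_eq_single i (fun j _ hj => by simp [hj]) (by simp)]
  simp

/-! ### The graded parts of the ideals `I^k I_1^{n_1} ⋯ I_p^{n_p} ℋ_t` -/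

section BlowUpPart

variable {p : ℕ} {R B : Type*} [CommRing R] [CommRing B] [Algebra R B]
  (𝒜 : (Fin p → ℕ) → Submodule R B) (H : Fin p → Submodule R B) (t : Fin p → ℕ)

/-- The part of degree `w` of the ideal `I^k I_1^{n_1} ⋯ I_p^{n_p} ℋ_t`. -/
def blowUpPart (k : ℕ) (w n : Fin p → ℕ) : Submodule R B :=
  ⨆ (x : (Fin p → ℕ) × (Fin p → ℕ)) (_ : x.1 + x.2 + n = w ∧ t ≤ x.2 ∧ ∑ i, x.1 i = k),
    (∏ i, H i ^ (n + x.1) i) * 𝒜 x.2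

variable {H t}

theorem le_blowUpPart (m u n : Fin p → ℕ) (hu : t ≤ u) :
    (∏ i, H i ^ (n + m) i) * 𝒜 u ≤ blowUpPart 𝒜 H t (∑ i, m i) (m + u + n) n :=
  le_iSup₂_of_le (m, u) ⟨rfl, hu, rfl⟩ le_rfl

theorem blowUpPart_le {k : ℕ} {w n : Fin p → ℕ} {N : Submodule R B}
    (h : ∀ m u, m + u + n = w → t ≤ u → ∑ i, m i = k → (∏ i, H i ^ (n + m) i) * 𝒜 u ≤ N) :
    blowUpPart 𝒜 H t k w n ≤ N :=
  iSup₂_le fun x hx => h x.1 x.2 hx.1 hx.2.1 hx.2.2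

theorem mul_blowUpPart_le {k : ℕ} {w n : Fin p → ℕ} {K N : Submodule R B}
    (h : ∀ m u, m + u + n = w → t ≤ u → ∑ i, m i = k → K * ((∏ i, H i ^ (n + m) i) * 𝒜 u) ≤ N) :
    K * blowUpPart 𝒜 H t k w n ≤ N := by
  rw [blowUpPart, Submodule.mul_iSup]
  refine iSup_le fun x => ?_
  rw [Submodule.mul_iSup]
  exact iSup_le fun hx => h x.1 x.2 hx.1 hx.2.1 hx.2.2

/-- The ideal is generated in total degree `k + |n| + |t|`: no pair of exponents contributes below
it. -/
theorem blowUpPart_eq_bot {k : ℕ} {w n : Fin p → ℕ} (h : ∑ i, w i < k + ∑ i, n i + ∑ i, t i) :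
    blowUpPart 𝒜 H t k w n = ⊥ := by
  refine eq_bot_iff.2 (blowUpPart_le 𝒜 ?_)
  rintro m u rfl hu rfl
  have := Finset.sum_le_sum fun i (_ : i ∈ Finset.univ) => hu i
  simp only [Pi.add_apply, Finset.sum_add_distrib] at h
  omega

theorem smul_mul_blowUpPart_le (k : ℕ) (w n : Fin p → ℕ) (i : Fin p) :
    H i * blowUpPart 𝒜 H t k w n ≤ blowUpPart 𝒜 H t (k + 1) (w + Pi.single i 1) n := by
  refine mul_blowUpPart_le 𝒜 ?_
  rintro m u rfl hu rfl
  have h := le_blowUpPart 𝒜 (H := H) (m + Pi.single i 1) u n hu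
  rw [← add_assoc, prod_pow_add_single, mul_assoc] at h
  convert h using 2
  · simp [Finset.sum_add_distrib]
  · ring

theorem mul_blowUpPart_le_add (k : ℕ) (w n : Fin p → ℕ) (i : Fin p) :
    H i * blowUpPart 𝒜 H t k w n ≤
      blowUpPart 𝒜 H t k (w + Pi.single i 1) (n + Pi.single i 1) := by
  refine mul_blowUpPart_le 𝒜 ?_
  rintro m u rfl hu rfl
  have h := le_blowUpPart 𝒜 (H := H) m u (n + Pi.single i 1) hu
  rw [add_right_comm, prod_pow_add_single, mul_assoc] at h
  convert h using 2
  ring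

variable {𝒜}

theorem blowUpPart_zero [GradedAlgebra 𝒜] {v : Fin p → ℕ} (hv : t ≤ v) (n : Fin p → ℕ) :
    blowUpPart 𝒜 H t 0 (v + n) n = powMul H n (𝒜 v) := by
  refine le_antisymm (blowUpPart_le 𝒜 fun m u h1 h2 h3 => ?_) ?_
  · obtain rfl : m = 0 := funext fun i => (Finset.sum_eq_zero_iff.1 h3) i (Finset.mem_univ i)
    rw [zero_add, add_left_inj] at h1
    rw [h1, add_zero]
    rfl
  · simpa [powMul] using le_blowUpPart 𝒜 (H := H) 0 v n hv

/-- In total degree equal to that of the generators there is no room for a coefficient of positive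
degree, so only `u = t` contributes. This is the end of the filtration whose start is
`blowUpPart_zero`. -/
theorem blowUpPart_last {v : Fin p → ℕ} (hv : t ≤ v) (n : Fin p → ℕ) :
    blowUpPart 𝒜 H t (∑ i, v i - ∑ i, t i) (v + n) n = powMul H (v + n - t) (𝒜 t) := by
  have ht : ∑ i, t i ≤ ∑ i, v i := Finset.sum_le_sum fun i _ => hv i
  refine le_antisymm (blowUpPart_le 𝒜 fun m u h1 h2 h3 => ?_) ?_
  · rw [add_left_inj] at h1
    subst h1
    obtain rfl : u = t := by
      by_contra hne
      obtain ⟨i, hi⟩ := Function.ne_iff.1 hne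
      have : ∑ i, t i < ∑ i, u i := Finset.sum_lt_sum (fun i _ => h2 i)
        ⟨i, Finset.mem_univ i, lt_of_le_of_ne (h2 i) (Ne.symm hi)⟩
      simp only [Pi.add_apply, Finset.sum_add_distrib] at h3 ht
      omega
    rw [add_right_comm, add_tsub_cancel_right, add_comm]
    rfl
  · obtain ⟨m, rfl⟩ := exists_add_of_le hv
    have h := le_blowUpPart 𝒜 (H := H) m t n le_rfl
    rw [add_assoc, add_tsub_cancel_left, add_comm m n, add_comm t m]
    have e : ∑ i, (m + t) i - ∑ i, t i = ∑ i, m i := by simp [Finset.sum_add_distrib]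
    rw [e, (by ring : t + (n + m) = m + t + n)]
    exact h

variable (H t)

theorem graded_mul_blowUpPart_le (hB : IsStandardGraded 𝒜) [GradedAlgebra 𝒜] (k : ℕ)
    (w n d : Fin p → ℕ) : 𝒜 d * blowUpPart 𝒜 H t k w n ≤ blowUpPart 𝒜 H t k (w + d) n := by
  refine mul_blowUpPart_le 𝒜 ?_
  rintro m u rfl hu rfl
  have h := le_blowUpPart 𝒜 (H := H) m (u + d) n (hu.trans le_self_add)
  rw [← graded_mul hB] at h
  convert h using 1
  · ring
  · congr 1; ring

variable {H}

/-- One factor `H i ≤ [B]_{e_i}` is moved from the power of `I` into the coefficient. -/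
theorem blowUpPart_antitone [GradedAlgebra 𝒜]
    (hH : ∀ i, H i ≤ 𝒜 (Pi.single i 1)) (w n : Fin p → ℕ) :
    Antitone fun k => blowUpPart 𝒜 H t k w n := by
  refine antitone_nat_of_succ_le fun k => blowUpPart_le 𝒜 ?_
  rintro m u rfl hu hm
  obtain ⟨m', i, rfl, rfl⟩ := exists_eq_add_single hm
  have h := le_blowUpPart 𝒜 (H := H) m' (u + Pi.single i 1) n (hu.trans le_self_add)
  rw [← add_assoc, prod_pow_add_single, mul_comm (H i), mul_assoc]
  refine (mul_le_mul' le_rfl ((mul_le_mul' (hH i) le_rfl).trans (graded_mul_le 𝒜 _ _))).trans ?_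
  convert h using 2
  · rw [add_comm]
  · ring

theorem blowUpPart_le_graded [GradedAlgebra 𝒜] (hH : ∀ i, H i ≤ 𝒜 (Pi.single i 1)) (k : ℕ)
    (w n : Fin p → ℕ) : blowUpPart 𝒜 H t k w n ≤ 𝒜 w := by
  refine blowUpPart_le 𝒜 ?_
  rintro m u rfl hu hm
  refine ((mul_le_mul' (prod_pow_le_graded 𝒜 hH _) le_rfl).trans (graded_mul_le 𝒜 _ _)).trans
    (le_of_eq ?_)
  congr 1; ring

end BlowUpPart

/-! ### The truncated blow-up family, its lengths and its generators -/

section Family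

variable {p : ℕ} {R B : Type*} [CommRing R] [CommRing B] [Algebra R B]
  (𝒜 : (Fin p → ℕ) → Submodule R B) (H : Fin p → Submodule R B) (t : Fin p → ℕ)

/-- The exponent `(k, n)` of the monomial `T^k T_1^{n_1} ⋯ T_p^{n_p}`. -/
noncomputable def jointExponent (k : ℕ) (n : Fin p → ℕ) : Option (Fin p) →₀ ℕ :=
  Finsupp.equivFunOnFinite.symm fun o => o.elim k n

@[simp] theorem jointExponent_none (k : ℕ) (n : Fin p → ℕ) : jointExponent k n none = k := rfl

@[simp] theorem jointExponent_some (k : ℕ) (n : Fin p → ℕ) (i : Fin p) :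
    jointExponent k n (some i) = n i := rfl

theorem eq_jointExponent {m : Option (Fin p) →₀ ℕ} {n : Fin p → ℕ} (h : ∀ i, m (some i) = n i) :
    m = jointExponent (m none) n := by
  ext o
  cases o with
  | none => rfl
  | some i => exact h i

open Classical in
/-- The polynomials in `T^k T_1^{n_1} ⋯ T_p^{n_p}`, for `k + |t| < |v|`, whose coefficients lie in
the part of degree `v + n` of `I^{k + j} I_1^{n_1} ⋯ I_p^{n_p} ℋ_t`. -/
noncomputable def truncFamily (j : ℕ) (v n : Fin p → ℕ) :
    Submodule R (MvPolynomial (Option (Fin p)) B) :=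
  coeffSubmodule fun m => if (∀ i, m (some i) = n i) ∧ m none + ∑ i, t i < ∑ i, v i then
    blowUpPart 𝒜 H t (m none + j) (v + n) n else ⊥

variable {𝒜 H t}

theorem mem_truncFamily {j : ℕ} {v n : Fin p → ℕ} {f : MvPolynomial (Option (Fin p)) B} :
    f ∈ truncFamily 𝒜 H t j v n ↔ ∀ m,
      ((∀ i, m (some i) = n i) ∧ m none + ∑ i, t i < ∑ i, v i →
        f.coeff m ∈ blowUpPart 𝒜 H t (m none + j) (v + n) n) ∧
      (¬((∀ i, m (some i) = n i) ∧ m none + ∑ i, t i < ∑ i, v i) → f.coeff m = 0) := by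
  classical
  refine forall_congr' fun m => ?_
  beta_reduce
  split_ifs with h <;> simp [h]

theorem monomial_mul_mem_truncFamily {j : ℕ} {v n v' n' : Fin p → ℕ} {s : Option (Fin p) →₀ ℕ}
    {b : B} {f : MvPolynomial (Option (Fin p)) B} (hf : f ∈ truncFamily 𝒜 H t j v n)
    (h : ∀ m : Option (Fin p) →₀ ℕ, (∀ i, m (some i) = n i) → m none + ∑ i, t i < ∑ i, v i →
      ∀ x ∈ blowUpPart 𝒜 H t (m none + j) (v + n) n,
        (∀ i, (s + m) (some i) = n' i) ∧ (s + m) none + ∑ i, t i < ∑ i, v' i ∧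
          b * x ∈ blowUpPart 𝒜 H t ((s + m) none + j) (v' + n') n') :
    MvPolynomial.monomial s b * f ∈ truncFamily 𝒜 H t j v' n' := by
  classical
  intro m
  rw [MvPolynomial.coeff_monomial_mul']
  split_ifs with hs
  · obtain ⟨m, rfl⟩ := exists_add_of_le hs
    rw [add_tsub_cancel_left]
    by_cases hm : (∀ i, m (some i) = n i) ∧ m none + ∑ i, t i < ∑ i, v i
    · have := h m hm.1 hm.2 _ ((mem_truncFamily.1 hf m).1 hm)
      beta_reduce
      rw [if_pos ⟨this.1, this.2.1⟩]
      exact this.2.2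
    · rw [(mem_truncFamily.1 hf m).2 hm, mul_zero]
      exact zero_mem _
  · exact zero_mem _

/-- The quotient splits along the powers `T^k` into the successive quotients of the filtration
`blowUpPart`, for `k < |v| - |t|`; their lengths telescope. -/
theorem relLength_truncFamily [GradedAlgebra 𝒜]
    (hH : ∀ i, H i ≤ 𝒜 (Pi.single i 1)) {v : Fin p → ℕ} (hv : t ≤ v) (n : Fin p → ℕ) :
    relLength (truncFamily 𝒜 H t 0 v n) (truncFamily 𝒜 H t 1 v n) = lengthFun 𝒜 H t v n := by
  classical
  set K := ∑ i, v i - ∑ i, t i with hK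
  have hmono := blowUpPart_antitone t hH (v + n) n
  have hinj : Set.InjOn (fun k => jointExponent k n) (Finset.range K : Set ℕ) :=
    fun a _ b _ h => DFunLike.congr_fun h none
  rw [truncFamily, truncFamily, relLength_coeffSubmodule
    ((Finset.range K).image fun k => jointExponent k n), Finset.sum_image hinj]
  · calc _ = ∑ k ∈ Finset.range K, relLength (blowUpPart 𝒜 H t k (v + n) n)
          (blowUpPart 𝒜 H t (k + 1) (v + n) n) := by
          refine Finset.sum_congr rfl fun k hk => ?_
          have : k + ∑ i, t i < ∑ i, v i := by
            have := Finset.mem_range.1 hk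
            omega
          simp [this]
      _ = _ := by
          rw [← relLength_sum hmono, blowUpPart_zero hv, hK, blowUpPart_last hv]
          rfl
  · intro m
    split_ifs
    · exact hmono (Nat.le_succ _)
    · exact le_rfl
  · intro m hm
    rw [if_neg, if_neg]
    all_goals
      rintro ⟨h1, h2⟩
      refine hm (Finset.mem_image.2 ⟨m none, Finset.mem_range.2 (by omega), ?_⟩)
      exact (eq_jointExponent h1).symm

theorem span_mul_le {S : Set B} {M N : Submodule R B} (h : ∀ g ∈ S, ∀ x ∈ M, g * x ∈ N) :
    Submodule.span R S * M ≤ N := by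
  refine Submodule.mul_le.2 fun a ha x hx => ?_
  induction ha using Submodule.span_induction with
  | mem a ha => exact h a ha x hx
  | zero => rw [zero_mul]; exact zero_mem _
  | add a b _ _ ha hb => rw [add_mul]; exact add_mem ha hb
  | smul r a _ ha => rw [smul_mul_assoc]; exact Submodule.smul_mem _ _ ha

theorem elim_add_single_inl (v n : Fin p → ℕ) (i : Fin p) :
    Sum.elim v n + Pi.single (Sum.inl i) 1 = Sum.elim (v + Pi.single i 1) n := by
  ext (j | j) <;> simp [Pi.single_apply]

theorem elim_add_single_inr (v n : Fin p → ℕ) (i : Fin p) :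
    Sum.elim v n + Pi.single (Sum.inr i) 1 = Sum.elim v (n + Pi.single i 1) := by
  ext (j | j) <;> simp [Pi.single_apply]

/-- The directions of the generators of `ℭ` over `R`. -/
def generatorDirection (gx gh : Fin p → Finset B) :
    ((Σ i, gx i) ⊕ (Σ i, gh i) ⊕ (Σ i, gh i)) → Fin p ⊕ Fin p
  | .inl x => .inl x.1
  | .inr (.inl x) => .inl x.1
  | .inr (.inr x) => .inr x.1

/-- The generators of `ℭ` over `R`: generators `b` of `B`, the elements `h T` and `h T_i` for
generators `h` of the `H_i`. -/
noncomputable def generatorElement (gx gh : Fin p → Finset B) :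
    ((Σ i, gx i) ⊕ (Σ i, gh i) ⊕ (Σ i, gh i)) → MvPolynomial (Option (Fin p)) B
  | .inl x => MvPolynomial.monomial 0 x.2
  | .inr (.inl x) => MvPolynomial.monomial (Finsupp.single none 1) x.2
  | .inr (.inr x) => MvPolynomial.monomial (Finsupp.single (some x.1) 1) x.2

/-- Each generator respects the bound `k + |t| < |v|`: an element of `[B]_{e_i}` raises only `v`, an
element `h T` raises `k` and `|v|` together, and an element `h T_i` raises only `n`. -/
theorem isStable_truncFamily [GradedAlgebra 𝒜] (hB : IsStandardGraded 𝒜) {gx gh : Fin p → Finset B}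
    (hgx : ∀ i, Submodule.span R (gx i : Set B) = 𝒜 (Pi.single i 1))
    (hgh : ∀ i, Submodule.span R (gh i : Set B) = H i) (j : ℕ) :
    IsStable (generatorDirection gx gh) (generatorElement gx gh)
      (fun x => truncFamily 𝒜 H t j (x ∘ Sum.inl) (x ∘ Sum.inr)) := by
  intro k x f hf
  obtain ⟨v, n, rfl⟩ : ∃ v n, x = Sum.elim v n := ⟨_, _, (Sum.elim_comp_inl_inr x).symm⟩
  simp only [Sum.elim_comp_inl, Sum.elim_comp_inr] at hf
  have hsum : ∀ (v : Fin p → ℕ) i, ∑ j, (v + Pi.single i 1 : Fin p → ℕ) j = ∑ j, v j + 1 :=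
    fun v i => by simp [Finset.sum_add_distrib]
  match k with
  | .inl ⟨i, g⟩ =>
    simp only [generatorDirection, generatorElement, elim_add_single_inl, Sum.elim_comp_inl,
      Sum.elim_comp_inr]
    have hg : (g : B) ∈ 𝒜 (Pi.single i 1) := hgx i ▸ Submodule.subset_span g.2
    refine monomial_mul_mem_truncFamily hf fun m h1 h2 x hx => ⟨fun i => by simpa using h1 i, ?_, ?_⟩
    · rw [hsum, zero_add]; omega
    · rw [zero_add, add_right_comm]
      exact graded_mul_blowUpPart_le H t hB _ _ _ _ (Submodule.mul_mem_mul hg hx)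
  | .inr (.inl ⟨i, g⟩) =>
    simp only [generatorDirection, generatorElement, elim_add_single_inl, Sum.elim_comp_inl,
      Sum.elim_comp_inr]
    have hg : (g : B) ∈ H i := hgh i ▸ Submodule.subset_span g.2
    refine monomial_mul_mem_truncFamily hf fun m h1 h2 x hx => ⟨fun i => by simpa using h1 i, ?_, ?_⟩
    · rw [hsum, Finsupp.add_apply, Finsupp.single_eq_same]; omega
    · rw [Finsupp.add_apply, Finsupp.single_eq_same, add_right_comm v, add_comm 1, add_right_comm]
      exact smul_mul_blowUpPart_le 𝒜 _ _ _ i (Submodule.mul_mem_mul hg hx)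
  | .inr (.inr ⟨i, g⟩) =>
    simp only [generatorDirection, generatorElement, elim_add_single_inr, Sum.elim_comp_inl,
      Sum.elim_comp_inr]
    have hg : (g : B) ∈ H i := hgh i ▸ Submodule.subset_span g.2
    refine monomial_mul_mem_truncFamily hf fun m h1 h2 x hx => ⟨fun l => ?_, ?_, ?_⟩
    · simp [h1 l, Finsupp.single_apply, Pi.single_apply, add_comm, eq_comm]
    · simpa using h2
    · rw [Finsupp.add_apply, Finsupp.single_eq_of_ne (by simp), zero_add, ← add_assoc]
      exact mul_blowUpPart_le_add 𝒜 _ _ _ i (Submodule.mul_mem_mul hg hx)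

/-- Starting from generators of `[B]_t` in degree `(t, 0)`, multiplication by `[B]_{e_i}` gives all
`[B]_{t+d}`, then the `h T` give the powers counted by `k`, then the `h T_i` those counted by `n`.
The truncated family is zero in degree `(t, 0)`; it is only a subfamily of what is generated, which
suffices. -/
theorem isNoetherianFamily_truncFamily [IsNoetherianRing R] [GradedAlgebra 𝒜]
    (hB : IsStandardGraded 𝒜) {gx gh : Fin p → Finset B}
    (hgx : ∀ i, Submodule.span R (gx i : Set B) = 𝒜 (Pi.single i 1))
    (hgh : ∀ i, Submodule.span R (gh i : Set B) = H i) :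
    IsNoetherianFamily (generatorDirection gx gh) (generatorElement gx gh)
      (fun x => truncFamily 𝒜 H t 0 (x ∘ Sum.inl) (x ∘ Sum.inr)) := by
  classical
  obtain ⟨gt, hgt⟩ := graded_fg hB t
  refine isNoetherianFamily_of_generated (γ := gt) _ _ _ (fun _ => Sum.elim t 0)
    (fun b => MvPolynomial.monomial 0 b) fun W hW hgen => ?_
  let T : ℕ → (Fin p → ℕ) → (Fin p → ℕ) → Submodule R B := fun k v n =>
    (W (Sum.elim v n)).comap ((MvPolynomial.monomial (jointExponent k n)).restrictScalars R)
  have hT : ∀ k v n x, x ∈ T k v n ↔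
      MvPolynomial.monomial (jointExponent k n) x ∈ W (Sum.elim v n) := fun _ _ _ _ => Iff.rfl
  have hTx : ∀ i k v n, 𝒜 (Pi.single i 1) * T k v n ≤ T k (v + Pi.single i 1) n := by
    intro i k v n
    rw [← hgx i]
    refine span_mul_le fun g hg x hx => ?_
    have h := hW (.inl ⟨i, g, hg⟩) _ _ ((hT _ _ _ _).1 hx)
    simp only [generatorDirection, generatorElement, elim_add_single_inl] at h
    rwa [MvPolynomial.monomial_mul, zero_add] at h
  have hTh : ∀ i k v n, H i * T k v n ≤ T (k + 1) (v + Pi.single i 1) n := by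
    intro i k v n
    rw [← hgh i]
    refine span_mul_le fun g hg x hx => ?_
    have h := hW (.inr (.inl ⟨i, g, hg⟩)) _ _ ((hT _ _ _ _).1 hx)
    simp only [generatorDirection, generatorElement, elim_add_single_inl] at h
    rw [MvPolynomial.monomial_mul] at h
    rw [hT]
    convert h using 3
    ext (_ | l) <;> simp [add_comm]
  have hTn : ∀ i k v n, H i * T k v n ≤ T k v (n + Pi.single i 1) := by
    intro i k v n
    rw [← hgh i]
    refine span_mul_le fun g hg x hx => ?_
    have h := hW (.inr (.inr ⟨i, g, hg⟩)) _ _ ((hT _ _ _ _).1 hx)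
    simp only [generatorDirection, generatorElement, elim_add_single_inr] at h
    rw [MvPolynomial.monomial_mul] at h
    rw [hT]
    convert h using 3
    ext (_ | l) <;> simp [add_comm, Finsupp.single_apply, Pi.single_apply, eq_comm]
  have h1 : ∀ d, 𝒜 (t + d) ≤ T 0 (t + d) 0 := by
    intro d
    induction d using pi_nat_induction with
    | zero =>
      rw [add_zero, ← hgt, Submodule.span_le]
      intro g hg
      have h := hgen ⟨g, hg⟩
      have e : jointExponent 0 (0 : Fin p → ℕ) = 0 := by ext (_ | l) <;> rfl
      rwa [SetLike.mem_coe, hT, e]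
    | add d i ih =>
      rw [← add_assoc, add_comm (t + d), ← graded_mul hB, add_comm _ (t + d)]
      exact (mul_le_mul' le_rfl ih).trans (hTx i _ _ _)
  have h2 : ∀ m d, (∏ i, H i ^ m i) * 𝒜 (t + d) ≤ T (∑ i, m i) (m + (t + d)) 0 := by
    intro m d
    induction m using pi_nat_induction with
    | zero => simpa using h1 d
    | add m i ih =>
      rw [prod_pow_add_single, mul_assoc, add_right_comm]
      refine (mul_le_mul' le_rfl ih).trans ((hTh i _ _ _).trans (le_of_eq ?_))
      simp [Finset.sum_add_distrib]
  have h3 : ∀ n m d, (∏ i, H i ^ (n + m) i) * 𝒜 (t + d) ≤ T (∑ i, m i) (m + (t + d)) n := by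
    intro n m d
    induction n using pi_nat_induction with
    | zero => simpa using h2 m d
    | add n i ih =>
      rw [add_right_comm, prod_pow_add_single, mul_assoc]
      exact (mul_le_mul' le_rfl ih).trans (hTn i _ _ _)
  intro x f hf
  obtain ⟨v, n, rfl⟩ : ∃ v n, x = Sum.elim v n := ⟨_, _, (Sum.elim_comp_inl_inr x).symm⟩
  simp only [Sum.elim_comp_inl, Sum.elim_comp_inr] at hf
  rw [f.as_sum]
  refine Submodule.sum_mem _ fun m hm => ?_
  have hc := (mem_truncFamily.1 hf m)
  have hm' : (∀ i, m (some i) = n i) ∧ m none + ∑ i, t i < ∑ i, v i := by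
    by_contra h
    exact MvPolynomial.mem_support_iff.1 hm (hc.2 h)
  have hle : blowUpPart 𝒜 H t (m none) (v + n) n ≤ T (m none) v n := by
    refine blowUpPart_le 𝒜 fun m' u e1 e2 e3 => ?_
    obtain ⟨d, rfl⟩ := exists_add_of_le e2
    rw [add_left_inj] at e1
    rw [← e1, ← e3]
    exact h3 n m' d
  have := hle (hc.1 hm')
  rwa [hT, ← eq_jointExponent hm'.1] at this

end Family

/-! ### Ideals given by their homogeneous components -/

section GradedIdeal

variable {p : ℕ} {R B : Type*} [CommRing R] [CommRing B] [Algebra R B]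
  (𝒜 : (Fin p → ℕ) → Submodule R B) [GradedAlgebra 𝒜]

/-- The ideal of the elements of `B` whose component of degree `w` lies in `F w`, for all `w`. -/
def gradedIdeal (F : (Fin p → ℕ) → Submodule R B) (hF : ∀ d w, 𝒜 d * F w ≤ F (w + d)) :
    Ideal B where
  carrier := {b | ∀ w, (DirectSum.decompose 𝒜 b w : B) ∈ F w}
  add_mem' ha hb w := by
    rw [DirectSum.decompose_add, DirectSum.add_apply, Submodule.coe_add]
    exact add_mem (ha w) (hb w)
  zero_mem' w := by simp
  smul_mem' a b hb w := by
    classical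
    rw [smul_eq_mul]
    induction a using DirectSum.Decomposition.inductionOn 𝒜 with
    | zero => simp
    | @homogeneous d a =>
      rw [DirectSum.coe_decompose_mul_of_left_mem 𝒜 w a.2]
      split_ifs with h
      · have := hF d (w - d) (Submodule.mul_mem_mul a.2 (hb _))
        rwa [tsub_add_cancel_of_le h] at this
      · exact zero_mem _
    | add a a' ha ha' =>
      rw [add_mul, DirectSum.decompose_add, DirectSum.add_apply, Submodule.coe_add]
      exact add_mem ha ha'

variable {𝒜} {F F' : (Fin p → ℕ) → Submodule R B} {hF : ∀ d w, 𝒜 d * F w ≤ F (w + d)}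
  {hF' : ∀ d w, 𝒜 d * F' w ≤ F' (w + d)}

theorem mem_of_mem_gradedIdeal {w : Fin p → ℕ} {b : B} (hb : b ∈ gradedIdeal 𝒜 F hF)
    (hw : b ∈ 𝒜 w) : b ∈ F w := by
  have := hb w
  rwa [DirectSum.decompose_of_mem_same 𝒜 hw] at this

theorem span_le_gradedIdeal {S : Set B} (h : ∀ s ∈ S, ∃ d, s ∈ 𝒜 d ∧ s ∈ F d) :
    Ideal.span S ≤ gradedIdeal 𝒜 F hF := by
  refine Ideal.span_le.2 fun s hs w => ?_
  obtain ⟨d, hd, hsF⟩ := h s hs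
  by_cases hdw : d = w
  · subst hdw
    rwa [DirectSum.decompose_of_mem_same 𝒜 hd]
  · rw [DirectSum.decompose_of_mem_ne 𝒜 hd hdw]
    exact zero_mem _

theorem span_mul_gradedIdeal_le {S : Set B}
    (h : ∀ s ∈ S, ∃ d, s ∈ 𝒜 d ∧ ∀ w, ∀ x ∈ F w, s * x ∈ F' (w + d)) :
    Ideal.span S * gradedIdeal 𝒜 F hF ≤ gradedIdeal 𝒜 F' hF' := by
  classical
  refine Ideal.mul_le.2 fun a ha b hb => ?_
  induction ha using Submodule.span_induction with
  | mem s hs =>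
    intro w
    obtain ⟨d, hd, hsF⟩ := h s hs
    rw [DirectSum.coe_decompose_mul_of_left_mem 𝒜 w hd]
    split_ifs with hdw
    · have := hsF (w - d) _ (hb _)
      rwa [tsub_add_cancel_of_le hdw] at this
    · exact zero_mem _
  | zero => rw [zero_mul]; exact zero_mem _
  | add a a' _ _ ha ha' => rw [add_mul]; exact add_mem ha ha'
  | smul c a _ ha => rw [smul_mul_assoc]; exact Ideal.mul_mem_left _ _ ha

end GradedIdeal

/-! ### The homogeneous components of the joint ideals, and their products with `B_+` -/

section Components

variable {p : ℕ} {R B : Type*} [CommRing R] [CommRing B] [Algebra R B]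
  (𝒜 : (Fin p → ℕ) → Submodule R B) (H : Fin p → Submodule R B) (t : Fin p → ℕ)

/-- The ideal `I^k I_1^{n_1} ⋯ I_p^{n_p} ℋ_t`. -/
def jointIdeal (k : ℕ) (n : Fin p → ℕ) : Ideal B :=
  sumIdeal (idealsOf H) ^ k * ((∏ i, idealsOf H i ^ n i) * idealOfDegree 𝒜 t)

theorem prod_extendedFamily (m : Option (Fin p) →₀ ℕ) :
    (∏ o, extendedFamily (idealsOf H) o ^ m o) * idealOfDegree 𝒜 t =
      jointIdeal 𝒜 H t (m none) (fun i => m (some i)) := by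
  rw [Fintype.prod_option, mul_assoc]
  rfl

theorem sumIdeal_mul_jointIdeal (k : ℕ) (n : Fin p → ℕ) :
    sumIdeal (idealsOf H) * jointIdeal 𝒜 H t k n = jointIdeal 𝒜 H t (k + 1) n := by
  rw [jointIdeal, jointIdeal, pow_succ', mul_assoc]

variable {𝒜 H t} [GradedAlgebra 𝒜]

/-- The ideal is built up from `ℋ_t` one factor at a time; each factor `I_i` is generated by
homogeneous elements of degree `e_i`, which move `blowUpPart` as required. -/
theorem jointIdeal_le_gradedIdeal (hB : IsStandardGraded 𝒜) (hH : ∀ i, H i ≤ 𝒜 (Pi.single i 1))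
    (k : ℕ) (n : Fin p → ℕ) : jointIdeal 𝒜 H t k n ≤
      gradedIdeal 𝒜 (fun w => blowUpPart 𝒜 H t k w n)
        (fun d w => graded_mul_blowUpPart_le H t hB k w n d) := by
  induction k with
  | zero =>
    rw [jointIdeal, pow_zero, one_mul]
    induction n using pi_nat_induction with
    | zero =>
      simp only [Pi.zero_apply, pow_zero, Finset.prod_const_one, one_mul]
      refine span_le_gradedIdeal fun b hb => ⟨t, hb, ?_⟩
      have := blowUpPart_zero (H := H) (𝒜 := 𝒜) (le_refl t) 0
      rw [add_zero] at this
      rw [this]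
      simpa [powMul] using hb
    | add n i ih =>
      rw [prod_pow_add_single, mul_assoc]
      refine (mul_le_mul' le_rfl ih).trans (span_mul_gradedIdeal_le fun h hh =>
        ⟨Pi.single i 1, hH i hh, fun w x hx => ?_⟩)
      exact mul_blowUpPart_le_add 𝒜 _ _ _ i (Submodule.mul_mem_mul hh hx)
  | succ k ih =>
    rw [← sumIdeal_mul_jointIdeal, sumIdeal, Finset.sum_mul]
    rw [Ideal.sum_eq_sup]
    refine Finset.sup_le fun i _ => ?_
    refine (mul_le_mul' le_rfl ih).trans (span_mul_gradedIdeal_le fun h hh =>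
      ⟨Pi.single i 1, hH i hh, fun w x hx => ?_⟩)
    exact smul_mul_blowUpPart_le 𝒜 _ _ _ i (Submodule.mul_mem_mul hh hx)

theorem mem_blowUpPart_of_mem_jointIdeal (hB : IsStandardGraded 𝒜)
    (hH : ∀ i, H i ≤ 𝒜 (Pi.single i 1)) {k : ℕ} {w n : Fin p → ℕ} {b : B}
    (hb : b ∈ jointIdeal 𝒜 H t k n) (hw : b ∈ 𝒜 w) : b ∈ blowUpPart 𝒜 H t k w n :=
  mem_of_mem_gradedIdeal (F := fun w => blowUpPart 𝒜 H t k w n)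
    (jointIdeal_le_gradedIdeal hB hH k n hb) hw

theorem mul_le_restrictScalars {M N : Submodule R B} {K L : Ideal B}
    (h₁ : M ≤ K.restrictScalars R) (h₂ : N ≤ L.restrictScalars R) :
    M * N ≤ (K * L).restrictScalars R :=
  Submodule.mul_le.2 fun _ ha _ hb => Ideal.mul_mem_mul (h₁ ha) (h₂ hb)

theorem prod_pow_le_ideal (m n : Fin p → ℕ) : ∏ i, H i ^ (n + m) i ≤
    (sumIdeal (idealsOf H) ^ (∑ i, m i) * ∏ i, idealsOf H i ^ n i).restrictScalars R := by
  have h0 : ∀ i, H i ≤ (idealsOf H i).restrictScalars R := fun i => Ideal.subset_span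
  have h1 : ∀ i, H i ≤ (sumIdeal (idealsOf H)).restrictScalars R := fun i =>
    (h0 i).trans fun x hx => by
      rw [sumIdeal, Ideal.sum_eq_sup]
      exact Finset.le_sup (f := idealsOf H) (Finset.mem_univ i) hx
  induction m using pi_nat_induction with
  | zero =>
    rw [add_zero]
    induction n using pi_nat_induction with
    | zero =>
      simp only [Pi.zero_apply, pow_zero, Finset.sum_const_zero, Finset.prod_const_one, one_mul]
      rw [Ideal.one_eq_top]
      exact fun _ _ => trivial
    | add n i ih =>
      rw [prod_pow_add_single, prod_pow_add_single, mul_left_comm]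
      exact mul_le_restrictScalars (h0 i) ih
  | add m i ih =>
    rw [← add_assoc, prod_pow_add_single]
    have e : ∑ j, (m + Pi.single i 1 : Fin p → ℕ) j = ∑ j, m j + 1 := by
      simp [Finset.sum_add_distrib]
    rw [e, pow_succ', mul_assoc]
    exact mul_le_restrictScalars (h1 i) ih

theorem blowUpPart_le_jointIdeal (hB : IsStandardGraded 𝒜) (k : ℕ) (w n : Fin p → ℕ) :
    blowUpPart 𝒜 H t k w n ≤ (jointIdeal 𝒜 H t k n).restrictScalars R := by
  refine blowUpPart_le 𝒜 ?_
  rintro m u - hu rfl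
  rw [jointIdeal, ← mul_assoc]
  refine mul_le_restrictScalars (prod_pow_le_ideal m n) ?_
  obtain ⟨d, rfl⟩ := exists_add_of_le hu
  rw [← graded_mul hB]
  exact Submodule.mul_le.2 fun a ha b _ => Ideal.mul_mem_right _ _ (Ideal.subset_span ha)

/-- Above the generating degree the coefficient has degree `u = t + d` with `|d| > 0`, so it
supplies a factor from `[B]_d`, which lies in `B_+`. -/
theorem blowUpPart_le_idealPlus_mul (hB : IsStandardGraded 𝒜) {k : ℕ} {w n : Fin p → ℕ}
    (h : k + ∑ i, n i + ∑ i, t i < ∑ i, w i) : blowUpPart 𝒜 H t k w n ≤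
      (idealPlus 𝒜 * jointIdeal 𝒜 H t k n).restrictScalars R := by
  refine blowUpPart_le 𝒜 ?_
  rintro m u rfl hu rfl
  obtain ⟨d, rfl⟩ := exists_add_of_le hu
  have hd : 0 < ∑ i, d i := by
    simp only [Pi.add_apply, Finset.sum_add_distrib] at h
    omega
  rw [jointIdeal, mul_left_comm, mul_left_comm (idealPlus 𝒜), ← mul_assoc, ← graded_mul hB,
    mul_comm (𝒜 t)]
  exact mul_le_restrictScalars (prod_pow_le_ideal m n) (mul_le_restrictScalars
    (fun a ha => Ideal.subset_span ⟨d, hd, ha⟩) Ideal.subset_span)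

/-- Both `B_+` and `I` push the ideal strictly above its generating total degree. The summand with
`I` is there because elements of `𝔊` are known only modulo `I`. -/
theorem eq_zero_of_mem_idealPlus_mul (hB : IsStandardGraded 𝒜)
    (hH : ∀ i, H i ≤ 𝒜 (Pi.single i 1)) {k : ℕ} {w n : Fin p → ℕ}
    (h : ∑ i, w i ≤ k + ∑ i, n i + ∑ i, t i) {b : B} (hw : b ∈ 𝒜 w)
    (hb : b ∈ idealPlus 𝒜 * jointIdeal 𝒜 H t k n ⊔
      sumIdeal (idealsOf H) * jointIdeal 𝒜 H t k n) : b = 0 := by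
  classical
  let j := k + ∑ i, n i + ∑ i, t i
  -- The components of the ideal of all elements that live in total degree greater than `j`.
  let F : (Fin p → ℕ) → Submodule R B := fun w => if j < ∑ i, w i then ⊤ else ⊥
  have hF : ∀ d w, 𝒜 d * F w ≤ F (w + d) := by
    intro d w
    by_cases hw : j < ∑ i, w i
    · have : j < ∑ i, (w + d) i := hw.trans_le (Finset.sum_le_sum fun i _ => Nat.le_add_right _ _)
      have e : F (w + d) = ⊤ := if_pos this
      rw [e]
      exact le_top
    · simp [F, hw]
  have hle : ∀ k' w, k ≤ k' → (k < k' ∨ j < ∑ i, w i) → blowUpPart 𝒜 H t k' w n ≤ F w := by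
    intro k' w hk hkw
    by_cases hw : j < ∑ i, w i
    · simp [F, hw]
    · rw [blowUpPart_eq_bot 𝒜 (by omega)]
      exact bot_le
  have h1 : idealPlus 𝒜 * jointIdeal 𝒜 H t k n ≤ gradedIdeal 𝒜 F hF := by
    refine (mul_le_mul' le_rfl (jointIdeal_le_gradedIdeal hB hH k n)).trans
      (span_mul_gradedIdeal_le ?_)
    rintro s ⟨d, hd, hs⟩
    refine ⟨d, hs, fun w x hx => ?_⟩
    by_cases hw : j < ∑ i, (w + d) i
    · have e : F (w + d) = ⊤ := if_pos hw
      rw [e]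
      trivial
    · rw [blowUpPart_eq_bot (w := w) 𝒜 (by
        simp only [Pi.add_apply, Finset.sum_add_distrib] at hw; omega)] at hx
      rw [(Submodule.mem_bot R).1 hx, mul_zero]
      exact zero_mem _
  have h2 : sumIdeal (idealsOf H) * jointIdeal 𝒜 H t k n ≤ gradedIdeal 𝒜 F hF := by
    rw [sumIdeal_mul_jointIdeal]
    refine (jointIdeal_le_gradedIdeal hB hH (k + 1) n).trans fun b hb w => ?_
    exact hle (k + 1) w (Nat.le_succ k) (Or.inl (Nat.lt_succ_self k)) (hb w)
  have := mem_of_mem_gradedIdeal (sup_le h1 h2 hb) hw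
  simpa [F, not_lt.2 h, j] using this

end Components

/-! ### The submodules `Kℭ_J` and `K𝔊_J`, coefficient by coefficient -/

section JointModule

variable {p : ℕ} {B : Type*} [CommRing B] (I : Fin p → Ideal B) (J K : Ideal B)

theorem coeff_mem_of_mem_map_smul {c : JointReesModule I J}
    (hc : c ∈ (K.map (algebraMap B (JointRees I)) • ⊤ : Submodule (JointRees I) _))
    (m : Option (Fin p) →₀ ℕ) :
    c.1.coeff m ∈ K * ((∏ o, extendedFamily I o ^ m o) * J) := by
  refine Submodule.smul_induction_on hc (fun r hr z _ => ?_) (fun x y hx hy => ?_)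
  · induction hr using Submodule.span_induction generalizing z with
    | mem r hr =>
      obtain ⟨a, ha, rfl⟩ := hr
      have e : (algebraMap B (JointRees I) a • z).1 = MvPolynomial.C a * z.1 := rfl
      rw [e, MvPolynomial.coeff_C_mul]
      exact Ideal.mul_mem_mul ha (z.2 m)
    | zero => rw [zero_smul]; exact zero_mem _
    | add r s _ _ hr hs =>
      rw [add_smul]
      exact add_mem (hr z trivial) (hs z trivial)
    | smul s r _ hr =>
      rw [smul_eq_mul, mul_comm s r, mul_smul]
      exact hr (s • z) trivial
  · exact add_mem hx hy

theorem mem_map_smul_of_coeff_mem {c : JointReesModule I J}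
    (hc : ∀ m, c.1.coeff m ∈ K * ((∏ o, extendedFamily I o ^ m o) * J)) :
    c ∈ (K.map (algebraMap B (JointRees I)) • ⊤ : Submodule (JointRees I) _) := by
  have h : c.1 ∈ K • (multiReesModule (extendedFamily I) J).restrictScalars B :=
    (mem_ideal_smul_iff K (fun m => (∏ o, extendedFamily I o ^ m o) * J) _
      (fun g => Iff.rfl) c.1).2 hc
  suffices H : ∀ x ∈ K • (multiReesModule (extendedFamily I) J).restrictScalars B,
      ∃ z ∈ (K.map (algebraMap B (JointRees I)) • ⊤ :
        Submodule (JointRees I) (JointReesModule I J)), z.1 = x by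
    obtain ⟨z, hz, e⟩ := H _ h
    rwa [Subtype.ext e] at hz
  intro x hx
  refine Submodule.smul_induction_on hx (fun a ha z hz => ?_) ?_
  · let z' : JointReesModule I J := ⟨z, hz⟩
    refine ⟨algebraMap B (JointRees I) a • z',
      Submodule.smul_mem_smul (Ideal.mem_map_of_mem _ ha) trivial, ?_⟩
    exact (MvPolynomial.smul_eq_C_mul z a).symm
  · rintro _ _ ⟨z, hz, rfl⟩ ⟨z', hz', rfl⟩
    exact ⟨z + z', add_mem hz hz', rfl⟩

theorem exists_of_mem_idealSmulModule {y : JointBlowUpModule I J}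
    (hy : y ∈ idealSmulModule I J K) :
    ∃ c ∈ (K.map (algebraMap B (JointRees I)) • ⊤ :
      Submodule (JointRees I) (JointReesModule I J)), Submodule.Quotient.mk c = y := by
  refine Submodule.smul_induction_on hy (fun r hr z _ => ?_) ?_
  · induction hr using Submodule.span_induction generalizing z with
    | mem r hr =>
      obtain ⟨a, ha, rfl⟩ := hr
      obtain ⟨z, rfl⟩ := Submodule.Quotient.mk_surjective _ z
      exact ⟨algebraMap B (JointRees I) a • z,
        Submodule.smul_mem_smul (Ideal.mem_map_of_mem _ ha) trivial, rfl⟩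
    | zero => exact ⟨0, zero_mem _, by rw [zero_smul]; rfl⟩
    | add r s _ _ hr hs =>
      obtain ⟨c, hc, e⟩ := hr z trivial
      obtain ⟨c', hc', e'⟩ := hs z trivial
      exact ⟨c + c', add_mem hc hc', by rw [add_smul, ← e, ← e']; rfl⟩
    | smul s r _ hr =>
      rw [smul_eq_mul, mul_comm s r, mul_smul]
      exact hr (s • z) trivial
  · rintro _ _ ⟨z, hz, rfl⟩ ⟨z', hz', rfl⟩
    exact ⟨z + z', add_mem hz hz', rfl⟩

theorem mk_mem_idealSmulModule {c : JointReesModule I J}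
    (hc : c ∈ (K.map (algebraMap B (JointRees I)) • ⊤ : Submodule (JointRees I) _)) :
    (Submodule.Quotient.mk c : JointBlowUpModule I J) ∈ idealSmulModule I J K := by
  refine Submodule.smul_induction_on hc (fun r hr z _ => ?_) (fun x y hx hy => ?_)
  · induction hr using Submodule.span_induction generalizing z with
    | mem r hr =>
      obtain ⟨a, ha, rfl⟩ := hr
      exact Submodule.smul_mem_smul (N := ⊤) (n := (Submodule.Quotient.mk z : JointBlowUpModule I J))
        (Ideal.mem_map_of_mem (algebraMap B (JointBlowUp I)) ha) trivial
    | zero => rw [zero_smul]; exact zero_mem _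
    | add r s _ _ hr hs =>
      rw [add_smul]
      exact add_mem (hr z trivial) (hs z trivial)
    | smul s r _ hr =>
      rw [smul_eq_mul, mul_comm s r, mul_smul]
      exact hr (s • z) trivial
  · exact add_mem hx hy

end JointModule

/-! ### The graded parts of `B_+ 𝔊_{ℋ_t}` and their lengths -/

section PlusParts

variable {p : ℕ} {R B : Type*} [CommRing R] [CommRing B] [Algebra R B]
  {𝒜 : (Fin p → ℕ) → Submodule R B} {H : Fin p → Submodule R B} {t : Fin p → ℕ}

/-- The inclusion of `ℭ_J` into `B[T, T_1, …, T_p]`. -/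
def jointReesInclusion (I : Fin p → Ideal B) (J : Ideal B) :
    JointReesModule I J →ₗ[R] MvPolynomial (Option (Fin p)) B where
  toFun c := c.1
  map_add' _ _ := rfl
  map_smul' _ _ := rfl

/-- A class in `B_+ 𝔊` has a homogeneous representative `c` and a representative `c'` in `B_+ ℭ_J`,
which differ by an element of `Iℭ_J`. For `k + |t| ≥ |v|` the degree then forces the coefficient of
`c` to vanish; for smaller `k` membership in `B_+` is automatic. -/
theorem plusParts_eq_map [GradedAlgebra 𝒜] (hB : IsStandardGraded 𝒜)
    (hH : ∀ i, H i ≤ 𝒜 (Pi.single i 1)) (v n : Fin p → ℕ) :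
    plusParts 𝒜 H t v n = ((truncFamily 𝒜 H t 0 v n).comap (jointReesInclusion _ _)).map
      ((sumIdealJointRees (idealsOf H) • ⊤ : Submodule (JointRees (idealsOf H))
        (JointReesModule (idealsOf H) (idealOfDegree 𝒜 t))).mkQ.restrictScalars R) := by
  have hsum : ∀ v n : Fin p → ℕ, ∑ i, (v + n) i = ∑ i, v i + ∑ i, n i := fun v n => by
    simp [Finset.sum_add_distrib]
  refine le_antisymm ?_ ?_
  · rintro _ ⟨hy, c, hc, rfl⟩
    refine ⟨c, mem_truncFamily.2 fun m => ⟨fun hm => ?_, fun hm => ?_⟩, rfl⟩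
    · refine mem_blowUpPart_of_mem_jointIdeal hB hH ?_ (hc m).1
      have := c.2 m
      rw [prod_extendedFamily] at this
      rwa [← funext hm.1]
    · by_cases hmn : ∀ i, m (some i) = n i
      · obtain ⟨c', hc', e⟩ := exists_of_mem_idealSmulModule _ _ _ hy
        have h1 := coeff_mem_of_mem_map_smul _ _ _ hc' m
        have h2 := coeff_mem_of_mem_map_smul _ _ _ ((Submodule.Quotient.eq _).1 e.symm) m
        rw [prod_extendedFamily, funext hmn] at h1 h2
        refine eq_zero_of_mem_idealPlus_mul (t := t) hB hH (k := m none) (n := n) ?_ (hc m).1 ?_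
        · rw [hsum]
          have : ¬ m none + ∑ i, t i < ∑ i, v i := fun h => hm ⟨hmn, h⟩
          omega
        · have e : c.1.coeff m = c'.1.coeff m + (c - c').1.coeff m := by
            change _ = _ + (c.1 - c'.1).coeff m
            rw [MvPolynomial.coeff_sub]
            ring
          exact e ▸ add_mem (Ideal.mem_sup_left h1) (Ideal.mem_sup_right h2)
      · exact (hc m).2 (not_forall.1 hmn)
  · rintro _ ⟨c, hc, rfl⟩
    have hc := mem_truncFamily.1 (Submodule.mem_comap.1 hc)
    refine ⟨mk_mem_idealSmulModule _ _ _ (mem_map_smul_of_coeff_mem _ _ _ fun m => ?_),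
      c, fun m => ⟨?_, ?_⟩, rfl⟩
    · by_cases hm : (∀ i, m (some i) = n i) ∧ m none + ∑ i, t i < ∑ i, v i
      · rw [prod_extendedFamily, funext hm.1]
        exact blowUpPart_le_idealPlus_mul hB (by rw [hsum]; have := hm.2; omega) ((hc m).1 hm)
      · have := (hc m).2 hm
        change c.1.coeff m = 0 at this
        rw [this]
        exact zero_mem _
    · by_cases hm : (∀ i, m (some i) = n i) ∧ m none + ∑ i, t i < ∑ i, v i
      · exact blowUpPart_le_graded t hH _ _ _ ((hc m).1 hm)
      · have := (hc m).2 hm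
        change c.1.coeff m = 0 at this
        rw [this]
        exact zero_mem _
    · rintro ⟨i, hi⟩
      exact (hc m).2 fun h => hi (h.1 i)

/-- The length is carried from `𝔊_J` to `ℭ_J` along the quotient map, then to the polynomial ring
along the inclusion. Modulo `Iℭ_J` means raising the power of `I` by one, which is the shift from
`0` to `1` in `truncFamily`. -/
theorem length_plusParts [GradedAlgebra 𝒜] (hB : IsStandardGraded 𝒜)
    (hH : ∀ i, H i ≤ 𝒜 (Pi.single i 1)) {v : Fin p → ℕ} (hv : t ≤ v) (n : Fin p → ℕ) :
    Module.length R (plusParts 𝒜 H t v n) = lengthFun 𝒜 H t v n := by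
  rw [← relLength_truncFamily hH hv, ← relLength_bot, plusParts_eq_map hB hH]
  trans relLength ((truncFamily 𝒜 H t 0 v n).comap (jointReesInclusion (idealsOf H) (idealOfDegree 𝒜 t)))
    ((truncFamily 𝒜 H t 1 v n).comap (jointReesInclusion (idealsOf H) (idealOfDegree 𝒜 t)))
  · refine relLength_eq_of_map _ (fun c hc => ⟨c, hc, rfl⟩) (fun c hc => ?_) ?_
    · have hc := mem_truncFamily.1 (Submodule.mem_comap.1 hc)
      rw [Submodule.mem_bot]
      refine Iff.trans (Submodule.Quotient.mk_eq_zero _) ⟨fun h => ?_, fun h => ?_⟩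
      · refine mem_truncFamily.2 fun m => ⟨fun hm => ?_, (hc m).2⟩
        have h1 := coeff_mem_of_mem_map_smul _ _ _ h m
        rw [prod_extendedFamily, sumIdeal_mul_jointIdeal, funext hm.1] at h1
        exact mem_blowUpPart_of_mem_jointIdeal hB hH h1
          (blowUpPart_le_graded t hH _ _ _ ((hc m).1 hm))
      · have h := mem_truncFamily.1 (Submodule.mem_comap.1 h)
        refine mem_map_smul_of_coeff_mem _ _ _ fun m => ?_
        by_cases hm : (∀ i, m (some i) = n i) ∧ m none + ∑ i, t i < ∑ i, v i
        · rw [prod_extendedFamily, sumIdeal_mul_jointIdeal, funext hm.1]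
          exact blowUpPart_le_jointIdeal hB _ _ _ ((h m).1 hm)
        · have := (h m).2 hm
          change c.1.coeff m = 0 at this
          rw [this]
          exact zero_mem _
    · rintro _ ⟨c, hc, rfl⟩
      exact ⟨c, hc, by simp⟩
  · refine (relLength_eq_of_map (jointReesInclusion _ _) (fun c hc => hc) (fun c _ => Iff.rfl)
      fun f hf => ?_).symm
    have hf' := mem_truncFamily.1 hf
    have hmem : f ∈ multiReesModule (extendedFamily (idealsOf H)) (idealOfDegree 𝒜 t) := fun m => by
      by_cases hm : (∀ i, m (some i) = n i) ∧ m none + ∑ i, t i < ∑ i, v i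
      · rw [prod_extendedFamily, funext hm.1]
        exact blowUpPart_le_jointIdeal hB _ _ _ ((hf' m).1 hm)
      · rw [(hf' m).2 hm]
        exact zero_mem _
    refine ⟨⟨f, hmem⟩, hf, ?_⟩
    have e : f - jointReesInclusion (R := R) _ _ ⟨f, hmem⟩ = 0 := sub_self f
    rw [e]
    exact zero_mem _

end PlusParts

/-! ### Modules of finite length over a local ring -/

section FiniteLength

variable {R : Type*} [CommRing R] [IsLocalRing R]

/-- The descending chain `𝔪^k M` becomes stationary, and Nakayama's lemma makes its last term zero.
-/
theorem exists_pow_smul_top_eq_bot {M : Type*} [AddCommGroup M] [Module R M]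
    (h : Module.length R M ≠ ⊤) :
    ∃ c : ℕ, IsLocalRing.maximalIdeal R ^ c • (⊤ : Submodule R M) = ⊥ := by
  obtain ⟨_, _⟩ := isFiniteLength_iff_isNoetherian_isArtinian.1 (Module.length_ne_top_iff.1 h)
  let f : ℕ →o (Submodule R M)ᵒᵈ :=
    ⟨fun k => OrderDual.toDual (IsLocalRing.maximalIdeal R ^ k • ⊤),
      fun a b hab => Submodule.smul_mono_left (Ideal.pow_le_pow_right hab)⟩
  obtain ⟨c, hc⟩ := IsArtinian.monotone_stabilizes f
  have e : IsLocalRing.maximalIdeal R ^ c • (⊤ : Submodule R M) =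
      IsLocalRing.maximalIdeal R ^ (c + 1) • ⊤ := hc (c + 1) (Nat.le_succ c)
  refine ⟨c, Submodule.eq_bot_of_le_smul_of_le_jacobson_bot (IsLocalRing.maximalIdeal R) _
    (IsNoetherian.noetherian _) ?_ (IsLocalRing.maximalIdeal_le_jacobson _)⟩
  rw [← Submodule.mul_smul, ← pow_succ', ← e]

theorem exists_pow_smul_le {M : Type*} [AddCommGroup M] [Module R M] {N K : Submodule R M}
    (h : relLength N K ≠ ⊤) : ∃ c : ℕ, IsLocalRing.maximalIdeal R ^ c • N ≤ K := by
  obtain ⟨c, hc⟩ := exists_pow_smul_top_eq_bot h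
  refine ⟨c, Submodule.smul_le.2 fun r hr x hx => ?_⟩
  have h0 : r • (Submodule.Quotient.mk ⟨x, hx⟩ : ↥N ⧸ K.submoduleOf N) = 0 := by
    rw [← Submodule.mem_bot R, ← hc]
    exact Submodule.smul_mem_smul hr trivial
  rw [← Submodule.Quotient.mk_smul, Submodule.Quotient.mk_eq_zero] at h0
  exact h0

theorem exists_forall_pow_smul_le {ι M : Type*} [Fintype ι] [AddCommGroup M] [Module R M]
    {N K : ι → Submodule R M} (h : ∀ i, relLength (N i) (K i) ≠ ⊤) :
    ∃ c : ℕ, ∀ i, IsLocalRing.maximalIdeal R ^ c • N i ≤ K i := by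
  choose c hc using fun i => exists_pow_smul_le (h i)
  exact ⟨∑ i, c i, fun i => (Submodule.smul_mono_left (Ideal.pow_le_pow_right
    (Finset.single_le_sum (fun _ _ => Nat.zero_le _) (Finset.mem_univ i)))).trans (hc i)⟩

theorem le_localCohomologyZero {M : Type*} [AddCommGroup M] [Module R M] {N : Submodule R M}
    (h : Module.length R N ≠ ⊤) : N ≤ localCohomologyZero R M := by
  obtain ⟨c, hc⟩ := exists_pow_smul_top_eq_bot h
  intro x hx
  refine Submodule.mem_iSup_of_mem c ((Submodule.mem_torsionBySet_iff _ _).2 fun r => ?_)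
  have h0 : r.1 • (⟨x, hx⟩ : N) = 0 := by
    rw [← Submodule.mem_bot R, ← hc]
    exact Submodule.smul_mem_smul r.2 trivial
  exact congrArg Subtype.val h0

end FiniteLength

/-! ### Finiteness of `λ_t` and existence of its polynomial -/

section Bounds

variable {p : ℕ} {R B : Type*} [CommRing R] [CommRing B] [Algebra R B]

theorem ideal_smul_mul_le (I : Ideal R) (M N : Submodule R B) : I • (M * N) ≤ (I • M) * N := by
  refine Submodule.smul_le.2 fun r hr x hx => ?_
  induction hx using Submodule.mul_induction_on' with
  | mem_mul_mem a ha b hb =>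
    rw [← smul_mul_assoc]
    exact Submodule.mul_mem_mul (Submodule.smul_mem_smul hr ha) hb
  | add x _ y _ hx hy =>
    rw [smul_add]
    exact add_mem hx hy

variable {𝒜 : (Fin p → ℕ) → Submodule R B} [GradedAlgebra 𝒜] {H : Fin p → Submodule R B}
  {t : Fin p → ℕ}

/-- `[B]_d` is a product of `|d|` degree-one parts, and each costs a factor `I ^ c` to be moved into
the corresponding `H i`. -/
theorem pow_smul_graded_le_prod (hB : IsStandardGraded 𝒜) {I : Ideal R} {c : ℕ}
    (hc : ∀ i, I ^ c • 𝒜 (Pi.single i 1) ≤ H i) (d : Fin p → ℕ) :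
    I ^ (c * ∑ i, d i) • 𝒜 d ≤ ∏ i, H i ^ d i := by
  induction d using pi_nat_induction with
  | zero => simp [hB.degree_zero]
  | add d i ih =>
    have e : ∑ j, (d + Pi.single i 1 : Fin p → ℕ) j = ∑ j, d j + 1 := by
      simp [Finset.sum_add_distrib]
    rw [prod_pow_add_single, e, mul_add, mul_one, pow_add, ← graded_mul hB, Submodule.mul_smul,
      mul_comm (𝒜 d)]
    refine (Submodule.smul_mono le_rfl (ideal_smul_mul_le _ _ _)).trans ?_
    rw [mul_comm (_ • _)]
    refine (ideal_smul_mul_le _ _ _).trans ?_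
    rw [mul_comm]
    exact mul_le_mul' (hc i) ih

/-- The numerator is enlarged to `[B]_{v+n}`. The denominator is shrunk by writing `[B]_{v+n}` as
`[B]_{v+n-t} [B]_t` and moving the first factor into the product of the `H i`. -/
theorem lengthFun_le [IsLocalRing R] (hB : IsStandardGraded 𝒜)
    (hH : ∀ i, H i ≤ 𝒜 (Pi.single i 1)) {c : ℕ}
    (hc : ∀ i, IsLocalRing.maximalIdeal R ^ c • 𝒜 (Pi.single i 1) ≤ H i) {v n : Fin p → ℕ}
    (hv : t ≤ v) : lengthFun 𝒜 H t v n ≤ relLength (𝒜 (v + n))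
      (IsLocalRing.maximalIdeal R ^ (c * ∑ i, (v + n - t) i) • 𝒜 (v + n)) := by
  refine (relLength_mono_left _ ?_).trans (relLength_anti_right _ ?_)
  · rw [add_comm v n]
    exact (mul_le_mul' (prod_pow_le_graded 𝒜 hH n) le_rfl).trans (graded_mul_le 𝒜 n v)
  · have e : v + n = (v + n - t) + t := (tsub_add_cancel_of_le (hv.trans le_self_add)).symm
    conv_lhs => rw [e, ← graded_mul hB, ← e]
    exact (ideal_smul_mul_le _ _ _).trans (mul_le_mul' (pow_smul_graded_le_prod hB hc _) le_rfl)

theorem truncLength_bot (𝒜 : (Fin p → ℕ) → Submodule R B) (I : Ideal R) (w : Fin p → ℕ) (s : ℕ) :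
    truncLength 𝒜 I ⊥ w s = relLength (𝒜 w) (I ^ s • 𝒜 w) := by
  simp [truncLength]

theorem lengthFun_ne_top [IsLocalRing R] [IsNoetherianRing R] (hB : IsStandardGraded 𝒜)
    (hH : ∀ i, H i ≤ 𝒜 (Pi.single i 1)) (hlen : ∀ i, relLength (𝒜 (Pi.single i 1)) (H i) ≠ ⊤)
    {v : Fin p → ℕ} (hv : t ≤ v) (n : Fin p → ℕ) : lengthFun 𝒜 H t v n ≠ ⊤ := by
  obtain ⟨c, hc⟩ := exists_forall_pow_smul_le hlen
  exact ne_top_of_le_ne_top (relLength_pow_smul_ne_top (graded_fg hB _) _)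
    (lengthFun_le hB hH hc hv)

theorem localCohomologyZeroParts_plusParts [IsLocalRing R] [IsNoetherianRing R]
    (hB : IsStandardGraded 𝒜) (hH : ∀ i, H i ≤ 𝒜 (Pi.single i 1))
    (hlen : ∀ i, relLength (𝒜 (Pi.single i 1)) (H i) ≠ ⊤) {v : Fin p → ℕ} (hv : t ≤ v)
    (n : Fin p → ℕ) :
    localCohomologyZeroParts R (plusParts 𝒜 H t) v n = plusParts 𝒜 H t v n := by
  refine inf_eq_left.2 (le_localCohomologyZero ?_)
  rw [length_plusParts hB hH hv]
  exact lengthFun_ne_top hB hH hlen hv n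

theorem truncFamily_antitone (hH : ∀ i, H i ≤ 𝒜 (Pi.single i 1)) (v n : Fin p → ℕ) :
    Antitone fun j => truncFamily 𝒜 H t j v n := by
  intro j j' hj f hf
  have hf' := mem_truncFamily.1 hf
  exact mem_truncFamily.2 fun m => ⟨fun h => blowUpPart_antitone t hH _ _
    (Nat.add_le_add_left hj _) ((hf' m).1 h), (hf' m).2⟩

theorem exists_eventuallyEqPoly_lengthFun [IsLocalRing R] [IsNoetherianRing R]
    (hB : IsStandardGraded 𝒜) (hH : ∀ i, H i ≤ 𝒜 (Pi.single i 1))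
    (hlen : ∀ i, relLength (𝒜 (Pi.single i 1)) (H i) ≠ ⊤) :
    ∃ P, EventuallyEqPoly (lengthFun 𝒜 H t) P := by
  have hfg : ∀ i, (H i).FG := fun i => by
    have := isNoetherian_of_fg_of_noetherian _ (graded_fg hB (Pi.single i 1))
    have h := (IsNoetherian.noetherian ((H i).submoduleOf (𝒜 (Pi.single i 1)))).map
      (𝒜 (Pi.single i 1)).subtype
    rwa [Submodule.submoduleOf, Submodule.map_comap_subtype, inf_eq_right.2 (hH i)] at h
  choose gx hgx using fun i => graded_fg hB (Pi.single i 1)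
  choose gh hgh using hfg
  -- The sum of the `t i` is a single threshold that ensures `t ≤ v`.
  have key : ∀ x : Fin p ⊕ Fin p → ℕ, (∀ i, ∑ i, t i ≤ x i) →
      relLength (truncFamily 𝒜 H t 0 (x ∘ Sum.inl) (x ∘ Sum.inr))
        (truncFamily 𝒜 H t 1 (x ∘ Sum.inl) (x ∘ Sum.inr)) =
      lengthFun 𝒜 H t (x ∘ Sum.inl) (x ∘ Sum.inr) ∧
      lengthFun 𝒜 H t (x ∘ Sum.inl) (x ∘ Sum.inr) ≠ ⊤ := fun x hx => by
    have hv : t ≤ x ∘ Sum.inl := fun i =>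
      (Finset.single_le_sum (fun _ _ => Nat.zero_le _) (Finset.mem_univ i)).trans (hx _)
    exact ⟨relLength_truncFamily hH hv _, lengthFun_ne_top hB hH hlen hv _⟩
  obtain ⟨P, N, hN⟩ := exists_hilbertPolynomial (isNoetherianFamily_truncFamily hB hgx hgh)
    (isStable_truncFamily hB hgx hgh 0) (isStable_truncFamily (t := t) hB hgx hgh 1)
    (fun x => truncFamily_antitone hH _ _ zero_le_one)
    ⟨∑ i, t i, fun x hx => (key x hx).1.symm ▸ (key x hx).2⟩
  refine ⟨P, max N (∑ i, t i), fun v n hv hn => ?_⟩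
  have hx : ∀ i, max N (∑ i, t i) ≤ Sum.elim v n i := Sum.forall.2 ⟨hv, hn⟩
  obtain ⟨h1, h2⟩ := key (Sum.elim v n) fun i => (le_max_right _ _).trans (hx i)
  have h3 := hN (Sum.elim v n) fun i => (le_max_left _ _).trans (hx i)
  simp only [Sum.elim_comp_inl, Sum.elim_comp_inr] at h1 h2 h3
  rw [h1] at h3
  refine ⟨(lengthFun 𝒜 H t v n).toNat, (ENat.natCast_toNat h2).symm, ?_⟩
  rw [h3]
  congr 2
  funext i
  cases i <;> rfl

end Bounds

/-! ### Uniqueness and degree of Hilbert polynomials -/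

section Polynomials

variable {p : ℕ} {f g : (Fin p → ℕ) → (Fin p → ℕ) → ℕ∞} {P Q : MvPolynomial (Fin p ⊕ Fin p) ℚ}

theorem EventuallyEqPoly.congr (h : EventuallyEqPoly f P) {t : Fin p → ℕ}
    (hfg : ∀ v n, t ≤ v → g v n = f v n) : EventuallyEqPoly g P := by
  obtain ⟨N, hN⟩ := h
  refine ⟨max N (∑ i, t i), fun v n hv hn => ?_⟩
  rw [hfg v n fun i => (Finset.single_le_sum (fun _ _ => Nat.zero_le _)
    (Finset.mem_univ i)).trans ((le_max_right _ _).trans (hv i))]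
  exact hN v n (fun i => (le_max_left _ _).trans (hv i)) fun i => (le_max_left _ _).trans (hn i)

theorem elim_comp_cast (x : Fin p ⊕ Fin p → ℕ) :
    Sum.elim (fun i => (x (Sum.inl i) : ℚ)) (fun i => (x (Sum.inr i) : ℚ)) =
      fun i => (x i : ℚ) := by
  funext i
  cases i <;> rfl

theorem EventuallyEqPoly.unique (hP : EventuallyEqPoly f P) (hQ : EventuallyEqPoly f Q) :
    P = Q := by
  obtain ⟨N, hN⟩ := hP
  obtain ⟨M, hM⟩ := hQ
  refine eval_nat_eq_imp_eq (max N M) fun x hx => ?_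
  obtain ⟨a, ha, ha'⟩ := hN (x ∘ Sum.inl) (x ∘ Sum.inr) (fun i => (le_max_left _ _).trans (hx _))
    fun i => (le_max_left _ _).trans (hx _)
  obtain ⟨b, hb, hb'⟩ := hM (x ∘ Sum.inl) (x ∘ Sum.inr) (fun i => (le_max_right _ _).trans (hx _))
    fun i => (le_max_right _ _).trans (hx _)
  have e : a = b := by exact_mod_cast ha.symm.trans hb
  rw [← elim_comp_cast]
  exact ha'.trans ((congrArg Nat.cast e).trans hb'.symm)

theorem mixedMultiplicity_eq {R N : Type*} [CommRing R] [AddCommGroup N] [Module R N]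
    {𝒩 : (Fin p → ℕ) → (Fin p → ℕ) → Submodule R N} (h : IsHilbertPoly R 𝒩 P) (α β : Fin p → ℕ) :
    mixedMultiplicity R 𝒩 α β = normalizedCoeff P α β := by
  have h' : ∃ P, IsHilbertPoly R 𝒩 P := ⟨P, h⟩
  rw [mixedMultiplicity, dif_pos h', EventuallyEqPoly.unique h'.choose_spec h]

theorem EventuallyEqPoly.eq_zero (h : EventuallyEqPoly f P) (N : ℕ)
    (h0 : ∀ v n : Fin p → ℕ, (∀ i, N ≤ v i) → (∀ i, N ≤ n i) → f v n = 0) : P = 0 := by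
  refine h.unique ⟨N, fun v n hv hn => ⟨0, ?_, ?_⟩⟩
  · rw [h0 v n hv hn, Nat.cast_zero]
  · rw [map_zero, Nat.cast_zero]

theorem EventuallyEqPoly.totalDegree_le (h : EventuallyEqPoly f P) (N C r : ℕ)
    (hf : ∀ v n : Fin p → ℕ, (∀ i, N ≤ v i) → (∀ i, N ≤ n i) →
      f v n ≤ (C * (∑ i, (v + n) i) ^ r : ℕ)) : P.totalDegree ≤ r := by
  obtain ⟨M, hM⟩ := h
  refine totalDegree_le_of_eval_le P (max M N) r C fun x hx => ?_
  obtain ⟨l, hl, hl'⟩ := hM (x ∘ Sum.inl) (x ∘ Sum.inr) (fun i => (le_max_left _ _).trans (hx _))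
    fun i => (le_max_left _ _).trans (hx _)
  have hb := hf (x ∘ Sum.inl) (x ∘ Sum.inr) (fun i => (le_max_right _ _).trans (hx _))
    fun i => (le_max_right _ _).trans (hx _)
  rw [hl] at hb
  have hb' : l ≤ C * (∑ i, (x ∘ Sum.inl + x ∘ Sum.inr) i) ^ r := by exact_mod_cast hb
  have e : MvPolynomial.eval (fun i => (x i : ℚ)) P = l := by
    rw [← elim_comp_cast]
    exact hl'
  have es : ∑ i, x i = ∑ i, (x ∘ Sum.inl + x ∘ Sum.inr) i := by
    simp [Fintype.sum_sum_type, Finset.sum_add_distrib]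
  rw [e, abs_of_nonneg (Nat.cast_nonneg l)]
  rw [← es] at hb'
  exact_mod_cast hb'

end Polynomials

/-! ### The degree is at most the dimension of `MultiProj` -/

section Degree

variable {p : ℕ} {R B : Type*} [CommRing R] [IsLocalRing R] [IsNoetherianRing R] [CommRing B]
  [Algebra R B] {𝒜 : (Fin p → ℕ) → Submodule R B} [GradedAlgebra 𝒜] {H : Fin p → Submodule R B}
  {t : Fin p → ℕ} {P : MvPolynomial (Fin p ⊕ Fin p) ℚ}

theorem exists_lengthFun_le_growth (hB : IsStandardGraded 𝒜) (hH : ∀ i, H i ≤ 𝒜 (Pi.single i 1))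
    (hlen : ∀ i, relLength (𝒜 (Pi.single i 1)) (H i) ≠ ⊤) {e : ℕ}
    (he : ∀ P : MultiProj 𝒜, Order.coheight P < e) :
    ∃ N C c : ℕ, ∀ v n : Fin p → ℕ, (∀ i, N ≤ v i) →
      lengthFun 𝒜 H t v n ≤ (C * growth e ((c + 1) * (∑ i, (v + n) i) + 1) : ℕ) := by
  obtain ⟨c, hc⟩ := exists_forall_pow_smul_le hlen
  obtain ⟨N, C, hN⟩ := hasGrowth_of_coheight_lt hB ⊥ (Ideal.IsHomogeneous.bot 𝒜) e
    fun P _ => he P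
  refine ⟨max N (∑ i, t i), C, c, fun v n hv => ?_⟩
  have htv : t ≤ v := fun i => (Finset.single_le_sum (fun _ _ => Nat.zero_le _)
    (Finset.mem_univ i)).trans ((le_max_right _ _).trans (hv i))
  refine (lengthFun_le hB hH hc htv).trans ?_
  rw [← truncLength_bot]
  refine (hN (v + n) (fun i => ((le_max_left _ _).trans (hv i)).trans (Nat.le_add_right _ _))
    _).trans ?_
  refine Nat.cast_le.2 (Nat.mul_le_mul_left C (growth_mono e ?_))
  have : ∑ i, (v + n - t) i ≤ ∑ i, (v + n) i := Finset.sum_le_sum fun i _ => Nat.sub_le _ _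
  have := Nat.mul_le_mul_left c this
  rw [add_mul, one_mul]
  omega

/-- For dimension `r` the growth exponent is `e = r + 1`, so that `growth e` is the `r`-th power. If
`MultiProj` is empty, `e = 0` is allowed and `λ_t` is eventually zero; in infinite dimension there
is nothing to prove. -/
theorem degree_le_topologicalKrullDim (hp : 1 ≤ p) (hB : IsStandardGraded 𝒜)
    (hH : ∀ i, H i ≤ 𝒜 (Pi.single i 1)) (hlen : ∀ i, relLength (𝒜 (Pi.single i 1)) (H i) ≠ ⊤)
    (hP : EventuallyEqPoly (lengthFun 𝒜 H t) P) {d : Fin p ⊕ Fin p →₀ ℕ} (hd : d ∈ P.support) :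
    ((∑ i, d i : ℕ) : WithBot ℕ∞) ≤ topologicalKrullDim (MultiProj 𝒜) := by
  have hle := coheight_le_topologicalKrullDim (𝒜 := 𝒜)
  induction hD : topologicalKrullDim (MultiProj 𝒜) with
  | bot =>
    obtain ⟨N, C, c, hN⟩ := exists_lengthFun_le_growth (t := t) (e := 0) hB hH hlen fun Q => by
      simpa [hD] using hle Q
    have h0 : P = 0 := hP.eq_zero N fun v n hv _ => by simpa [growth] using hN v n hv
    simp [h0] at hd
  | coe D =>
    rw [hD] at hle
    induction D with
    | top => exact le_top
    | coe r =>
      obtain ⟨N, C, c, hN⟩ := exists_lengthFun_le_growth (t := t) (e := r + 1) hB hH hlen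
        fun Q => by
          have h := hle Q
          rw [WithBot.coe_le_coe] at h
          exact h.trans_lt (by exact_mod_cast Nat.lt_succ_self r)
      have hr : P.totalDegree ≤ r := by
        refine hP.totalDegree_le (max N 1) (C * (c + 2) ^ r) r fun v n hv _ => ?_
        refine (hN v n fun i => (le_max_left _ _).trans (hv i)).trans (Nat.cast_le.2 ?_)
        -- Positivity of `|v + n|` turns `(c + 1)|v + n| + 1` into at most `(c + 2)|v + n|`, the
        -- source of the constant `C (c + 2)^r`.
        have h1 : 1 ≤ ∑ i, (v + n) i :=
          ((le_max_right N 1).trans (hv ⟨0, hp⟩)).trans ((Nat.le_add_right _ _).trans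
            (Finset.single_le_sum (f := v + n) (fun _ _ => Nat.zero_le _) (Finset.mem_univ _)))
        rw [mul_assoc, ← mul_pow]
        refine Nat.mul_le_mul_left C (Nat.pow_le_pow_left ?_ r)
        nlinarith
      have h := MvPolynomial.le_totalDegree hd
      rw [Finsupp.sum_fintype _ _ fun _ => rfl] at h
      exact_mod_cast h.trans hr

end Degree

end NewJointBlowUp

/-! ### The main theorem -/

theorem mainTheorem6 {p : ℕ} (hp : 1 ≤ p) {R : Type*} {B : Type*} [CommRing R] [IsLocalRing R]
    [IsNoetherianRing R] [CommRing B] [Algebra R B] (𝒜 : (Fin p → ℕ) → Submodule R B)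
    [GradedAlgebra 𝒜] (hB : NewJointBlowUp.IsStandardGraded 𝒜)
    (H : Fin p → Submodule R B) (hH : ∀ i, H i ≤ 𝒜 (Pi.single i 1))
    (hlen : ∀ i, Module.length R
      (↥(𝒜 (Pi.single i 1)) ⧸ (H i).submoduleOf (𝒜 (Pi.single i 1))) ≠ ⊤)
    (t : Fin p → ℕ) :
    ∃ P : MvPolynomial (Fin p ⊕ Fin p) ℚ,
      NewJointBlowUp.EventuallyEqPoly (NewJointBlowUp.lengthFun 𝒜 H t) P ∧
      (∀ d ∈ P.support,
        ((∑ i, d i : ℕ) : WithBot ℕ∞) ≤ topologicalKrullDim (NewJointBlowUp.MultiProj 𝒜)) ∧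
      (∃ Q, NewJointBlowUp.IsHilbertPoly R (NewJointBlowUp.plusParts 𝒜 H t) Q) ∧
      (∃ Q, NewJointBlowUp.IsHilbertPoly R
        (NewJointBlowUp.localCohomologyZeroParts R (NewJointBlowUp.plusParts 𝒜 H t)) Q) ∧
      ∀ α β : Fin p → ℕ,
        ((∑ i, α i + ∑ i, β i : ℕ) : WithBot ℕ∞) = topologicalKrullDim (NewJointBlowUp.MultiProj 𝒜) →
        NewJointBlowUp.normalizedCoeff P α β =
            NewJointBlowUp.mixedJMultiplicity R (NewJointBlowUp.plusParts 𝒜 H t) α β ∧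
        NewJointBlowUp.normalizedCoeff P α β =
            NewJointBlowUp.mixedMultiplicity R (NewJointBlowUp.plusParts 𝒜 H t) α β := by
  obtain ⟨P, hP⟩ := NewJointBlowUp.exists_eventuallyEqPoly_lengthFun (t := t) hB hH hlen
  have h1 : NewJointBlowUp.IsHilbertPoly R (NewJointBlowUp.plusParts 𝒜 H t) P :=
    hP.congr fun v n hv => NewJointBlowUp.length_plusParts hB hH hv n
  have h2 : NewJointBlowUp.IsHilbertPoly R
      (NewJointBlowUp.localCohomologyZeroParts R (NewJointBlowUp.plusParts 𝒜 H t)) P :=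
    h1.congr fun v n hv => by
      rw [NewJointBlowUp.hilbertFun,
        NewJointBlowUp.localCohomologyZeroParts_plusParts hB hH hlen hv, NewJointBlowUp.hilbertFun]
  exact ⟨P, hP, fun d hd => NewJointBlowUp.degree_le_topologicalKrullDim hp hB hH hlen hP hd,
    ⟨P, h1⟩, ⟨P, h2⟩, fun α β _ => ⟨(NewJointBlowUp.mixedMultiplicity_eq h2 α β).symm,
      (NewJointBlowUp.mixedMultiplicity_eq h1 α β).symm⟩⟩
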